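/- Let $(R,\mathfrak m)$ be a commutative Noetherian local ring with $\dim R=1$, and let $M$ be a finitely generated $R$-module with rank, i.e. there is an integer $r\ge 0$ such that $M_{\mathfrak p}$ is a free $R_{\mathfrak p}$-module of rank $r$ for every associated prime $\mathfrak p$ of $R$. Assume that $r>0$ or $M=0$. Put $M^*=\operatorname{Hom}_R(M,R)$, let $\operatorname{tr}_R(M)\subseteq R$ be the image of the map $M^*\otimes_R M\to R$, $f\otimes x\mapsto f(x)$, and assume that $M\otimes_R M^*$ is torsionfree, i.e. no regular element (nonzerodivisor) of $R$ kills a nonzero element of $M\otimes_R M^*$. 1. If there exist an element $x\in R$ and an integer $n\ge 0$ such that $\operatorname{tr}_R(M)\subseteq\mathfrak m^n$ and $x\,\mathfrak m^n=\mathfrak m^{n+1}$, then $M$ is free. 2. In particular, if $R$ has minimal multiplicity, i.e. $e(R)=\operatorname{embdim}R-\dim R+1$, then $M$ is free. (Here $e(R)=\lim_{n\to\infty}\lambda(R/\mathfrak m^n)/n$, with $\lambda$ the length, is the multiplicity of the one-dimensional ring $R$, and $\operatorname{embdim}R=\dim_{R/\mathfrak m}\mathfrak m/\mathfrak m^2$.)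 -/

import Mathlib

open Filter Topology
open scoped TensorProduct Nat

/-- `M` has rank `r`: for every associated prime `p` of the ring `R`, the localization `M_p`
is a free `R_p`-module of rank `r`. -/
def HasModuleRank (R : Type*) [CommRing R] (M : Type*) [AddCommGroup M] [Module R M]
    (r : ℕ) : Prop :=
  ∀ (p : Ideal R) [p.IsPrime], p ∈ associatedPrimes R R →
    Module.Free (Localization.AtPrime p) (LocalizedModule p.primeCompl M) ∧
      Module.finrank (Localization.AtPrime p) (LocalizedModule p.primeCompl M) = r

/-- The trace ideal of `M`: the image of the evaluation map `M* ⊗ M → R`, `f ⊗ x ↦ f x`. -/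
noncomputable def traceIdeal (R : Type*) [CommRing R] (M : Type*) [AddCommGroup M]
    [Module R M] : Ideal R :=
  LinearMap.range (contractLeft R M)

/-- The Hilbert–Samuel function `n ↦ λ(R / 𝔪 ^ n)` of a local ring. The length is finite when
`R` is Noetherian, so that `ENat.toNat` loses nothing there. -/
noncomputable def hilbertSamuel (R : Type*) [CommRing R] [IsLocalRing R] (n : ℕ) : ℕ :=
  (Module.length R (R ⧸ IsLocalRing.maximalIdeal R ^ n)).toNat

/-- `e` is the multiplicity of the local ring `R`: for `d = dim R`,
`e = lim d! * λ(R / 𝔪 ^ n) / n ^ d`. -/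
def HasMultiplicity (R : Type*) [CommRing R] [IsLocalRing R] (e : ℕ) : Prop :=
  ∃ d : ℕ, ringKrullDim R = d ∧
    Tendsto (fun n : ℕ => ((d ! : ℕ) : ℝ) * (hilbertSamuel R n : ℝ) / (n : ℝ) ^ d)
      atTop (𝓝 (e : ℝ))

/-- The embedding dimension `dim_k (𝔪 / 𝔪 ^ 2)` of a local ring. -/
noncomputable def embDim (R : Type*) [CommRing R] [IsLocalRing R] : ℕ :=
  Module.finrank (IsLocalRing.ResidueField R) (IsLocalRing.CotangentSpace R)

/-- `R` has minimal multiplicity: `e(R) = embdim R - dim R + 1` (for Cohen–Macaulay `R`, equality in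
Abhyankar's inequality). -/
def HasMinimalMultiplicity (R : Type*) [CommRing R] [IsLocalRing R] : Prop :=
  ∃ d e : ℕ, ringKrullDim R = d ∧ HasMultiplicity R e ∧ e + d = embDim R + 1

/-! If 𝔪 is an associated prime, the rank hypothesis at 𝔪 already says that M is free. Otherwise 𝔪
contains a nonzerodivisor.

The core is a length count (`free_of_mul_traceIdeal_le`). Let A be a finite free R-algebra and x ∈ A
a nonunit dividing a nonzerodivisor of R, with 𝔪·tr(M)·A ⊆ xA. Put H = Hom(M, A). Maps M → A take
values in tr(M)A, so 𝔪 kills H/xH, and M ⊗ H/xH has length μ(M)·λ(H/xH), where μ is the minimal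
number of generators. But M ⊗ H is a sum of copies of M ⊗ M*, so x acts injectively on it, and since
M has rank r the same length is r·λ(H/xH). As 0 < λ(H/xH) < ∞, μ(M) = r, which forces M to be free.

Part 1 is the case A = R, since 𝔪·tr(M) ⊆ 𝔪^(n+1) ⊆ xR. For Part 2, free summands are split off
until tr(M) ⊆ 𝔪; it remains to find A and x with 𝔪²A ⊆ xA. As the residue field k may be finite, x
starts as a polynomial over R whose coefficients generate 𝔪. In large degrees it acts injectively on
gr(R)[X], so μ(𝔪^n) is eventually nondecreasing and equals e(R) at two consecutive n
(`minGenerators_pow_le_and_exists`, `exists_eq_of_tendsto_div`). There the determinant s of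
multiplication by x is nonzero modulo 𝔪. Passing to A = R[X]/(f) with s invertible in A gives x𝔪^nA
= 𝔪^(n+1)A (`exists_monic_map_pow_succ_eq`), and a length count using e(R) = μ(𝔪) turns this into
𝔪²A = x𝔪A. -/

/-! ### Lengths of cokernels -/

section Length

variable {R : Type*} [CommRing R]

/-- The length of the cokernel of a linear map. -/
noncomputable def cokerLength {M N : Type*} [AddCommGroup M] [AddCommGroup N] [Module R M]
    [Module R N] (f : M →ₗ[R] N) : ℕ∞ :=
  Module.length R (N ⧸ LinearMap.range f)

variable {M N P : Type*} [AddCommGroup M] [AddCommGroup N] [AddCommGroup P]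
  [Module R M] [Module R N] [Module R P]

/-- For injective g the cokernels form a short exact sequence 0 → coker f → coker (g ∘ f) → coker g
→ 0. -/
theorem cokerLength_comp (f : M →ₗ[R] N) (g : N →ₗ[R] P) (hg : Function.Injective g) :
    cokerLength (g ∘ₗ f) = cokerLength f + cokerLength g := by
  have h1 : LinearMap.range f ≤ (LinearMap.range (g ∘ₗ f)).comap g := by
    rintro _ ⟨y, rfl⟩
    exact ⟨y, rfl⟩
  have h2 : LinearMap.range (g ∘ₗ f) ≤ LinearMap.range g := LinearMap.range_comp_le_range f g
  refine Module.length_eq_add_of_exact (Submodule.mapQ _ _ g h1) (Submodule.factor h2) ?_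
    (Submodule.factor_surjective h2) ?_
  · rw [← LinearMap.ker_eq_bot, Submodule.mapQ, Submodule.ker_liftQ_eq_bot']
    ext y
    simp only [LinearMap.mem_range, LinearMap.mem_ker, LinearMap.comp_apply, Submodule.mkQ_apply,
      Submodule.Quotient.mk_eq_zero]
    exact ⟨fun ⟨z, hz⟩ => ⟨z, by rw [hz]⟩, fun ⟨z, hz⟩ => ⟨z, hg hz⟩⟩
  · intro y
    obtain ⟨y, rfl⟩ := Submodule.Quotient.mk_surjective _ y
    rw [← Submodule.mkQ_apply, Submodule.factor_mk, Submodule.mkQ_apply,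
      Submodule.Quotient.mk_eq_zero]
    constructor
    · rintro ⟨z, rfl⟩
      exact ⟨Submodule.Quotient.mk z, by simp⟩
    · rintro ⟨z, hz⟩
      obtain ⟨z, rfl⟩ := Submodule.Quotient.mk_surjective _ z
      rw [Submodule.mapQ_apply, Submodule.mkQ_apply, Submodule.Quotient.eq] at hz
      obtain ⟨w, hw⟩ := hz
      exact ⟨z - f w, by rw [map_sub, ← LinearMap.comp_apply, hw]; abel⟩

theorem cokerLength_eq_zero_iff (f : M →ₗ[R] N) :
    cokerLength f = 0 ↔ Function.Surjective f := by
  rw [cokerLength, Module.length_eq_zero_iff, Submodule.Quotient.subsingleton_iff,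
    LinearMap.range_eq_top]

/-- Conjugating an injective endomorphism along an injection with cokernel of finite length does
not change the length of its cokernel. -/
theorem cokerLength_eq_of_comp_eq (α : M →ₗ[R] N) (hα : Function.Injective α)
    (hfin : cokerLength α ≠ ⊤) (f : M →ₗ[R] M) (g : N →ₗ[R] N) (hg : Function.Injective g)
    (h : α ∘ₗ f = g ∘ₗ α) : cokerLength f = cokerLength g := by
  have h1 := cokerLength_comp f α hα
  rw [h, cokerLength_comp α g hg, add_comm] at h1
  exact (WithTop.add_right_cancel hfin h1).symm

theorem cokerLength_lTensor (f : N →ₗ[R] P) :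
    cokerLength (f.lTensor M) = Module.length R (M ⊗[R] (P ⧸ LinearMap.range f)) :=
  (lTensor.equiv M (LinearMap.exact_map_mkQ_range f) (Submodule.mkQ_surjective _)).length_eq

theorem length_pi_tensor (r : ℕ) :
    Module.length R ((Fin r → R) ⊗[R] M) = r * Module.length R M := by
  rw [((TensorProduct.comm R (Fin r → R) M).trans
    (TensorProduct.piScalarRight R R M (Fin r))).length_eq, Module.length_pi]
  simp

theorem cokerLength_lTensor_pi (r : ℕ) (f : N →ₗ[R] P) :
    cokerLength (f.lTensor (Fin r → R)) = r * cokerLength f := by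
  rw [cokerLength_lTensor, length_pi_tensor, cokerLength]

/-- The module is a quotient of a power of R/c, which has finite length because c is regular and dim
R ≤ 1. -/
theorem finite_length_of_smul_eq_zero [IsNoetherianRing R] [Ring.KrullDimLE 1 R]
    [Module.Finite R M] (c : R) (hc : c ∈ nonZeroDivisors R) (h : ∀ x : M, c • x = 0) :
    Module.length R M ≠ ⊤ := by
  have h1 : Module.length R (R ⧸ Ideal.span {c}) ≠ ⊤ := Ring.ord_ne_top hc
  have h2 := isFiniteLength_iff_isNoetherian_isArtinian.mp (Module.length_ne_top_iff.mp h1)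
  have : IsArtinian R (R ⧸ Ideal.span {c}) := h2.2
  have ht : Module.IsTorsionBySet R M (Ideal.span {c} : Ideal R) := by
    rw [Module.isTorsionBySet_span_singleton_iff]
    exact fun x => h x
  obtain ⟨s, f, hf⟩ := Module.Finite.exists_fin' R M
  have hle : ∀ i, Ideal.span {c} ≤ LinearMap.ker (f ∘ₗ LinearMap.single R (fun _ => R) i) := by
    intro i
    rw [Ideal.span_singleton_le_iff_mem, LinearMap.mem_ker]
    have : (Pi.single i c : Fin s → R) = c • Pi.single i 1 := by
      rw [← Pi.single_smul]; simp
    rw [LinearMap.comp_apply, LinearMap.single_apply, this, map_smul, h]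
  let g : (Fin s → R ⧸ Ideal.span {c}) →ₗ[R] M :=
    LinearMap.lsum R (fun _ => R ⧸ Ideal.span {c}) R
      (fun i => Submodule.liftQ _ (f ∘ₗ LinearMap.single R (fun _ => R) i) (hle i))
  have hg : Function.Surjective g := by
    intro y
    obtain ⟨z, rfl⟩ := hf y
    refine ⟨fun i => Submodule.Quotient.mk (z i), ?_⟩
    simp only [g, LinearMap.lsum_apply, LinearMap.sum_apply, LinearMap.comp_apply,
      LinearMap.proj_apply, Submodule.liftQ_apply, ← map_sum]
    congr 1
    exact Finset.univ_sum_single z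
  have := isArtinian_of_surjective _ g hg
  exact Module.length_ne_top

variable [IsLocalRing R]

theorem length_eq_finrank_residueField [Module.Finite R M]
    (h : ∀ a ∈ IsLocalRing.maximalIdeal R, ∀ x : M, a • x = 0) :
    Module.length R M = Module.finrank (IsLocalRing.ResidueField R)
      (IsLocalRing.ResidueField R ⊗[R] M) := by
  rw [← Module.length_eq_finrank, ← Module.length_eq_of_surjective (S := R)
    IsLocalRing.residue_surjective]
  have hbot : IsLocalRing.maximalIdeal R • (⊤ : Submodule R M) = ⊥ := by
    rw [eq_bot_iff, Submodule.smul_le]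
    exact fun a ha x _ => h a ha x
  exact ((TensorProduct.quotTensorEquivQuotSMul M (IsLocalRing.maximalIdeal R)).trans
    (Submodule.quotEquivOfEqBot _ hbot)).symm.length_eq

theorem length_tensor_of_smul_eq_zero [Module.Finite R M] [Module.Finite R N]
    (h : ∀ a ∈ IsLocalRing.maximalIdeal R, ∀ x : N, a • x = 0) :
    Module.length R (M ⊗[R] N) = Module.finrank (IsLocalRing.ResidueField R)
      (IsLocalRing.ResidueField R ⊗[R] M) * Module.length R N := by
  rw [length_eq_finrank_residueField h, length_eq_finrank_residueField (M := M ⊗[R] N),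
    (TensorProduct.AlgebraTensorModule.distribBaseChange R
      (IsLocalRing.ResidueField R) M N).finrank_eq, Module.finrank_tensorProduct, Nat.cast_mul]
  intro a ha z
  induction z with
  | zero => simp
  | add x y hx hy => rw [smul_add, hx, hy, add_zero]
  | tmul x y => rw [← TensorProduct.tmul_smul, h a ha, TensorProduct.tmul_zero]

end Length

/-! ### Generic freeness and its effect on lengths -/

section QuasiFree

variable {R : Type*} [CommRing R]

/-- `M` becomes isomorphic to `R ^ r` after inverting a suitable nonzerodivisor `c`, expressed by
a pair of maps whose composites are multiplication by `c`. -/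
def GenericallyFree (R : Type*) [CommRing R] (M : Type*) [AddCommGroup M] [Module R M]
    (r : ℕ) : Prop :=
  ∃ c ∈ nonZeroDivisors R, ∃ (α : (Fin r → R) →ₗ[R] M) (β : M →ₗ[R] (Fin r → R)),
    α ∘ₗ β = c • LinearMap.id ∧ β ∘ₗ α = c • LinearMap.id

variable {M N : Type*} [AddCommGroup M] [AddCommGroup N] [Module R M] [Module R N]

theorem injective_of_comp_eq_smul {f : M →ₗ[R] N} {g : N →ₗ[R] M} {c : R}
    (h : g ∘ₗ f = c • LinearMap.id) (hc : IsSMulRegular M c) : Function.Injective f := by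
  intro x y hxy
  apply hc
  have := congrArg g hxy
  rw [← LinearMap.comp_apply, ← LinearMap.comp_apply, h] at this
  simpa using this

/-- Generators lifted from a basis of k ⊗ M give a surjection R^r → M. Generic freeness gives an
injection R^r → M, so the Orzech property makes the surjection injective. -/
theorem GenericallyFree.free [IsLocalRing R] [Module.Finite R M] {r : ℕ}
    (hM : GenericallyFree R M r)
    (h : Module.finrank (IsLocalRing.ResidueField R) (IsLocalRing.ResidueField R ⊗[R] M) = r) :
    Module.Free R M := by
  obtain ⟨c, hc, α, β, -, h2⟩ := hM
  have hα : Function.Injective α :=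
    injective_of_comp_eq_smul h2 (IsSMulRegular.pi fun _ => (isRegular_iff_mem_nonZeroDivisors.mpr hc).1)
  let w := Module.finBasisOfFinrankEq (IsLocalRing.ResidueField R)
    (IsLocalRing.ResidueField R ⊗[R] M) h
  obtain ⟨v, hv⟩ := (TensorProduct.mk_surjective R M (IsLocalRing.ResidueField R)
    IsLocalRing.residue_surjective).comp_left w
  have hspan := IsLocalRing.span_eq_top_of_tmul_eq_basis v w fun i => congrFun hv i
  have hsurj : Function.Surjective (Fintype.linearCombination R v) := by
    rw [← LinearMap.range_eq_top, Fintype.range_linearCombination, hspan]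
  have hinj := OrzechProperty.injective_of_surjective_of_injective α _ hα hsurj
  exact Module.Free.of_equiv (LinearEquiv.ofBijective _ ⟨hinj, hsurj⟩)

theorem cokerLength_eq_of_comp_eq_smul [IsNoetherianRing R] [Ring.KrullDimLE 1 R]
    [Module.Finite R N] {c : R} (hc : c ∈ nonZeroDivisors R) (hcM : IsSMulRegular M c)
    {α : M →ₗ[R] N} {β : N →ₗ[R] M} (h1 : α ∘ₗ β = c • LinearMap.id)
    (h2 : β ∘ₗ α = c • LinearMap.id) (f : M →ₗ[R] M) (g : N →ₗ[R] N)
    (hg : Function.Injective g) (h : α ∘ₗ f = g ∘ₗ α) : cokerLength f = cokerLength g := by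
  refine cokerLength_eq_of_comp_eq α (injective_of_comp_eq_smul h2 hcM) ?_ f g hg h
  refine finite_length_of_smul_eq_zero c hc fun y => ?_
  obtain ⟨y, rfl⟩ := Submodule.Quotient.mk_surjective _ y
  rw [← Submodule.Quotient.mk_smul, Submodule.Quotient.mk_eq_zero]
  exact ⟨β y, by rw [← LinearMap.comp_apply, h1]; rfl⟩

theorem isSMulRegular_pi_tensor {c : R} (hc : IsSMulRegular N c) (r : ℕ) :
    IsSMulRegular ((Fin r → R) ⊗[R] N) c := by
  let e := (TensorProduct.comm R (Fin r → R) N).trans (TensorProduct.piScalarRight R R N (Fin r))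
  exact (e.isSMulRegular_congr c).mpr (IsSMulRegular.pi fun _ => hc)

/-- The maps α and β compare M ⊗ N with R^r ⊗ N up to finite length, and on the latter f acts as r
copies of itself. -/
theorem GenericallyFree.cokerLength_lTensor [IsNoetherianRing R] [Ring.KrullDimLE 1 R]
    [Module.Finite R M] [Module.Finite R N] {r : ℕ} (hM : GenericallyFree R M r)
    (hN : ∀ c ∈ nonZeroDivisors R, IsSMulRegular N c) (f : N →ₗ[R] N)
    (hf : Function.Injective (f.lTensor M)) :
    cokerLength (f.lTensor M) = r * cokerLength f := by
  obtain ⟨c, hc, α, β, h1, h2⟩ := hM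
  rw [← cokerLength_lTensor_pi]
  refine (cokerLength_eq_of_comp_eq_smul hc (isSMulRegular_pi_tensor (hN c hc) r)
    (α := α.rTensor N) (β := β.rTensor N) ?_ ?_ _ _ hf ?_).symm
  · rw [← LinearMap.rTensor_comp, h1, LinearMap.rTensor_smul, LinearMap.rTensor_id]
  · rw [← LinearMap.rTensor_comp, h2, LinearMap.rTensor_smul, LinearMap.rTensor_id]
  · rw [LinearMap.lTensor_comp_rTensor, LinearMap.rTensor_comp_lTensor]

/-- The same comparison for Hom(M, N), made through R^r ⊗ N ≅ Hom(R^r, N) followed by precomposition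
with β. -/
theorem GenericallyFree.cokerLength_compRight [IsNoetherianRing R] [Ring.KrullDimLE 1 R]
    [Module.Finite R M] [Module.Finite R N] {r : ℕ} (hM : GenericallyFree R M r)
    (hN : ∀ c ∈ nonZeroDivisors R, IsSMulRegular N c) (f : N →ₗ[R] N)
    (hf : Function.Injective f) :
    cokerLength (f.compRight R : (M →ₗ[R] N) →ₗ[R] (M →ₗ[R] N)) = r * cokerLength f := by
  obtain ⟨c, hc, α, β, h1, h2⟩ := hM
  rw [← cokerLength_lTensor_pi]
  let e : (Fin r → R) ⊗[R] N ≃ₗ[R] ((Fin r → R) →ₗ[R] N) :=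
    ((TensorProduct.comm R (Fin r → R) N).trans
      (TensorProduct.piScalarRight R R N (Fin r))).trans ((Pi.basisFun R (Fin r)).constr R)
  have he : ∀ u y v, e (u ⊗ₜ y) v = ∑ i, v i • u i • y := by
    intro u y v
    simp [e, Module.Basis.constr_apply_fintype]
  refine (cokerLength_eq_of_comp_eq_smul hc (isSMulRegular_pi_tensor (hN c hc) r)
    (α := LinearMap.lcomp R N β ∘ₗ e.toLinearMap)
    (β := e.symm.toLinearMap ∘ₗ LinearMap.lcomp R N α) ?_ ?_ _ _ ?_ ?_).symm
  · ext g m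
    have := congrArg (fun k => g (k m)) h1
    simpa using this
  · refine LinearMap.ext fun z => ?_
    apply e.injective
    ext v
    have := congrArg (fun k => e z (k (Pi.single v 1))) h2
    simpa using this
  · intro g g' h
    ext m
    exact hf (LinearMap.congr_fun h m)
  · refine TensorProduct.ext' fun u y => ?_
    ext m
    simp [he]

end QuasiFree

/-! ### The length count that forces freeness -/

section Core

variable {R : Type*} [CommRing R]

theorem apply_mem_traceIdeal {M : Type*} [AddCommGroup M] [Module R M] (f : Module.Dual R M)
    (y : M) : f y ∈ traceIdeal R M :=
  ⟨f ⊗ₜ y, contractLeft_apply f y⟩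

theorem exists_comp_eq_of_range_le {M N P : Type*} [AddCommGroup M] [AddCommGroup N]
    [AddCommGroup P] [Module R M] [Module R N] [Module R P] (f : N →ₗ[R] P)
    (hf : Function.Injective f) (g : M →ₗ[R] P) (h : ∀ y, g y ∈ LinearMap.range f) :
    ∃ k : M →ₗ[R] N, f ∘ₗ k = g := by
  refine ⟨(LinearEquiv.ofInjective f hf).symm.toLinearMap ∘ₗ g.codRestrict _ h, ?_⟩
  ext y
  simp

/-- A basis of A identifies M ⊗ Hom(M, A) with a power of M ⊗ M*. -/
theorem isSMulRegular_tensor_hom {A M : Type*} [AddCommGroup M] [Module R M] [AddCommGroup A]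
    [Module R A] [Module.Free R A] [Module.Finite R A]
    (htf : Module.IsTorsionFree R (M ⊗[R] Module.Dual R M)) (c : R)
    (hc : c ∈ nonZeroDivisors R) : IsSMulRegular (M ⊗[R] (M →ₗ[R] A)) c := by
  classical
  let b := (Module.Free.chooseBasis R A).equivFun
  let e : (M →ₗ[R] A) ≃ₗ[R] (Module.Free.ChooseBasisIndex R A → Module.Dual R M) :=
    (LinearEquiv.congrRight b).trans (LinearEquiv.linearMapPi R).symm
  let e' : M ⊗[R] (M →ₗ[R] A) ≃ₗ[R] (Module.Free.ChooseBasisIndex R A → M ⊗[R] Module.Dual R M) :=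
    (TensorProduct.congr (LinearEquiv.refl R M) e).trans (TensorProduct.piRight R R M _)
  exact (e'.isSMulRegular_congr c).mpr
    (IsSMulRegular.pi fun _ => htf.isSMulRegular (isRegular_iff_mem_nonZeroDivisors.mpr hc))

variable [IsNoetherianRing R] [IsLocalRing R] [Ring.KrullDimLE 1 R]

theorem free_of_mul_traceIdeal_le {A M : Type*} [AddCommGroup M] [Module R M] [Module.Finite R M]
    [CommRing A] [Algebra R A] [Module.Free R A] [Module.Finite R A] {r : ℕ}
    (hM : GenericallyFree R M r) (hr : 0 < r)
    (htf : Module.IsTorsionFree R (M ⊗[R] Module.Dual R M)) (x : A) (hx : ¬ IsUnit x)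
    {c : R} (hc : c ∈ nonZeroDivisors R) (hxc : algebraMap R A c ∈ Ideal.span {x})
    (htr : ∀ a ∈ IsLocalRing.maximalIdeal R, ∀ t ∈ traceIdeal R M,
      algebraMap R A (a * t) ∈ Ideal.span {x}) : Module.Free R M := by
  obtain ⟨z, hz⟩ := Ideal.mem_span_singleton'.mp hxc
  have hreg : ∀ c ∈ nonZeroDivisors R, IsSMulRegular A c := fun c hc =>
    ((Module.Free.chooseBasis R A).equivFun.isSMulRegular_congr c).mpr
      (IsSMulRegular.pi fun _ => (isRegular_iff_mem_nonZeroDivisors.mpr hc).1)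
  let f : A →ₗ[R] A := LinearMap.mulLeft R x
  have hzf : LinearMap.mulLeft R z ∘ₗ f = c • LinearMap.id := by
    ext y
    simp [f, ← mul_assoc, hz, Algebra.smul_def]
  have hf : Function.Injective f := injective_of_comp_eq_smul hzf (hreg c hc)
  let F : (M →ₗ[R] A) →ₗ[R] (M →ₗ[R] A) := f.compRight R
  have hzF : (LinearMap.mulLeft R z).compRight R ∘ₗ F = c • LinearMap.id := by
    ext g m
    exact LinearMap.congr_fun hzf (g m)
  have hHreg : ∀ c ∈ nonZeroDivisors R, IsSMulRegular (M →ₗ[R] A) c := by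
    intro c hc g g' h
    ext m
    exact hreg c hc (LinearMap.congr_fun h m)
  have hFT : Function.Injective (F.lTensor M) := by
    refine injective_of_comp_eq_smul (c := c)
      (g := ((LinearMap.mulLeft R z).compRight R).lTensor M) ?_ (isSMulRegular_tensor_hom htf c hc)
    rw [← LinearMap.lTensor_comp, hzF, LinearMap.lTensor_smul, LinearMap.lTensor_id]
  have hkill : ∀ a ∈ IsLocalRing.maximalIdeal R, ∀ g : (M →ₗ[R] A) ⧸ LinearMap.range F,
      a • g = 0 := by
    intro a ha g
    obtain ⟨g, rfl⟩ := Submodule.Quotient.mk_surjective _ g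
    rw [← Submodule.Quotient.mk_smul, Submodule.Quotient.mk_eq_zero]
    -- Multiplication by x is injective on A, so a map with values in xA is x times another map.
    suffices h : ∀ y, (a • g) y ∈ LinearMap.range f by
      obtain ⟨k, hk⟩ := exists_comp_eq_of_range_le f hf (a • g) h
      exact ⟨k, hk⟩
    intro y
    -- In a basis of A the coordinates of g are functionals on M, so those of g y lie in the trace
    -- ideal.
    have hmem : a • g y ∈ Ideal.span {x} := by
      let b := Module.Free.chooseBasis R A
      rw [← b.sum_repr (g y), Finset.smul_sum]
      refine Ideal.sum_mem _ fun i _ => ?_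
      rw [smul_smul, Algebra.smul_def]
      exact Ideal.mul_mem_right _ _
        (htr a ha _ (apply_mem_traceIdeal (b.coord i ∘ₗ g) y))
    obtain ⟨w, hw⟩ := Ideal.mem_span_singleton'.mp hmem
    exact ⟨w, by rw [LinearMap.smul_apply, ← hw, mul_comm]; rfl⟩
  have h1 : cokerLength F = r * cokerLength f := hM.cokerLength_compRight hreg f hf
  have h2 : cokerLength (F.lTensor M) = r * cokerLength F := hM.cokerLength_lTensor hHreg F hFT
  rw [cokerLength_lTensor, length_tensor_of_smul_eq_zero hkill, ← cokerLength] at h2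
  -- The length must be nonzero and finite in order to be cancelled from `h2`. It is nonzero because
  -- r > 0 and x is not a unit.
  have h3 : cokerLength F ≠ 0 := by
    rw [h1, mul_ne_zero_iff]
    refine ⟨by exact_mod_cast hr.ne', ?_⟩
    rw [Ne, cokerLength_eq_zero_iff]
    intro hs
    obtain ⟨y, hy⟩ := hs 1
    exact hx (IsUnit.of_mul_eq_one y hy)
  have h4 : cokerLength F ≠ ⊤ := by
    rw [cokerLength, length_eq_finrank_residueField hkill]
    exact ENat.natCast_ne_top _
  apply hM.free
  lift cokerLength F to ℕ using h4 with l
  have h5 : l ≠ 0 := by exact_mod_cast h3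
  exact Nat.eq_of_mul_eq_mul_right (Nat.pos_of_ne_zero h5) (by exact_mod_cast h2)

end Core

/-! ### From rank at the associated primes to generic freeness -/

section Rank

variable {R : Type*} [CommRing R] {M : Type*} [AddCommGroup M] [Module R M]

/-- A basis of a localization can be chosen in the image of the original module. -/
theorem exists_span_mkLinearMap_eq_top [Module.Finite R M] (p : Ideal R) [p.IsPrime] {r : ℕ}
    [Module.Free (Localization.AtPrime p) (LocalizedModule p.primeCompl M)]
    (h : Module.finrank (Localization.AtPrime p) (LocalizedModule p.primeCompl M) = r) :
    ∃ m : Fin r → M, Submodule.span (Localization.AtPrime p)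
      (Set.range (LocalizedModule.mkLinearMap p.primeCompl M ∘ m)) = ⊤ := by
  have : Module.Finite (Localization.AtPrime p) (LocalizedModule p.primeCompl M) :=
    Module.Finite.of_isLocalizedModule p.primeCompl (LocalizedModule.mkLinearMap p.primeCompl M)
  let b := Module.finBasisOfFinrankEq (Localization.AtPrime p)
    (LocalizedModule p.primeCompl M) h
  choose w hw using fun i => IsLocalizedModule.surj p.primeCompl
    (LocalizedModule.mkLinearMap p.primeCompl M) (b i)
  refine ⟨fun i => (w i).1, ?_⟩
  rw [eq_top_iff, ← b.span_eq, Submodule.span_le]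
  rintro _ ⟨i, rfl⟩
  have h1 : IsLocalization.mk' (Localization.AtPrime p) 1 (w i).2 •
      (LocalizedModule.mkLinearMap p.primeCompl M (w i).1) = b i := by
    rw [← hw i, Submonoid.smul_def, ← algebraMap_smul (Localization.AtPrime p) ((w i).2 : R),
      smul_smul, IsLocalization.mk'_spec, map_one, one_smul]
  rw [← h1]
  exact Submodule.smul_mem _ _ (Submodule.subset_span ⟨i, rfl⟩)

theorem exists_span_mkLinearMap_eq_top_of_finset [Module.Finite R M] {r : ℕ}
    (S : Finset (Ideal R)) (hprime : ∀ p ∈ S, p.IsPrime)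
    (hS : ∀ p ∈ S, ∀ q ∈ S, p ≤ q → p = q)
    (h : ∀ p ∈ S, ∀ [p.IsPrime], ∃ m : Fin r → M, Submodule.span (Localization.AtPrime p)
      (Set.range (LocalizedModule.mkLinearMap p.primeCompl M ∘ m)) = ⊤) :
    ∃ m : Fin r → M, ∀ p ∈ S, ∀ [p.IsPrime], Submodule.span (Localization.AtPrime p)
      (Set.range (LocalizedModule.mkLinearMap p.primeCompl M ∘ m)) = ⊤ := by
  classical
  -- The primes in S are incomparable, so the intersection of the others is not contained in p.
  have ha : ∀ p : S, ∃ a : R, a ∉ (p : Ideal R) ∧ ∀ q ∈ S, q ≠ p → a ∈ q := by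
    rintro ⟨p, hp⟩
    have hn : ¬ (S.erase p).inf id ≤ p := by
      rw [(hprime p hp).inf_le']
      rintro ⟨q, hq, hqp⟩
      rw [Finset.mem_erase] at hq
      exact hq.1 (hS q hq.2 p hp hqp)
    obtain ⟨a, ha1, ha2⟩ := SetLike.not_le_iff_exists.mp hn
    refine ⟨a, ha2, fun q hq hqp => ?_⟩
    exact (Finset.inf_le (f := id) (Finset.mem_erase.mpr ⟨hqp, hq⟩) : _ ≤ q) ha1
  choose a ha1 ha2 using ha
  choose w hw using fun p : S => (have := hprime p p.2; h p p.2)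
  -- After localizing at p, this sum agrees modulo the maximal ideal with the term of p, whose
  -- coefficient is a unit; Nakayama then gives spanning.
  refine ⟨fun i => ∑ p : S, a p • w p i, fun p hp _ => ?_⟩
  have : Module.Finite (Localization.AtPrime p) (LocalizedModule p.primeCompl M) :=
    Module.Finite.of_isLocalizedModule p.primeCompl (LocalizedModule.mkLinearMap p.primeCompl M)
  set f := LocalizedModule.mkLinearMap p.primeCompl M with hf
  rw [eq_top_iff]
  refine Submodule.le_of_le_smul_of_le_jacobson_bot
    (I := IsLocalRing.maximalIdeal (Localization.AtPrime p)) Module.Finite.fg_top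
    (IsLocalRing.maximalIdeal_le_jacobson _) ?_
  conv_lhs => rw [← hw ⟨p, hp⟩]
  rw [Submodule.span_le]
  rintro _ ⟨i, rfl⟩
  have hu : IsUnit (algebraMap R (Localization.AtPrime p) (a ⟨p, hp⟩)) :=
    IsLocalization.map_units _ (⟨a ⟨p, hp⟩, ha1 ⟨p, hp⟩⟩ : p.primeCompl)
  rw [SetLike.mem_coe, ← Submodule.smul_mem_iff_of_isUnit _ hu, algebraMap_smul,
    Function.comp_apply, ← map_smul]
  have hsum : a ⟨p, hp⟩ • w ⟨p, hp⟩ i = (∑ q : S, a q • w q i) -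
      ∑ q ∈ Finset.univ.erase (⟨p, hp⟩ : S), a q • w q i := by
    rw [eq_sub_iff_add_eq]
    exact Finset.add_sum_erase _ (fun q : S => a q • w q i) (Finset.mem_univ _)
  rw [hsum, map_sub]
  refine Submodule.sub_mem _ (Submodule.mem_sup_left (Submodule.subset_span ⟨i, rfl⟩))
    (Submodule.mem_sup_right ?_)
  rw [map_sum]
  refine Submodule.sum_mem _ fun q hq => ?_
  rw [map_smul, ← algebraMap_smul (Localization.AtPrime p) (a q)]
  refine Submodule.smul_mem_smul ?_ Submodule.mem_top
  rw [IsLocalization.AtPrime.to_map_mem_maximal_iff _ p]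
  exact ha2 q p hp fun hqp => (Finset.mem_erase.mp hq).1 (Subtype.ext hqp.symm)

theorem exists_smul_mem_span_of_span_mkLinearMap_eq_top {ι : Type*} (p : Ideal R) [p.IsPrime]
    (m : ι → M) (h : Submodule.span (Localization.AtPrime p)
      (Set.range (LocalizedModule.mkLinearMap p.primeCompl M ∘ m)) = ⊤) (y : M) :
    ∃ s ∉ p, s • y ∈ Submodule.span R (Set.range m) := by
  rw [Set.range_comp, ← Submodule.localized'_span (Localization.AtPrime p) p.primeCompl] at h
  have hy : LocalizedModule.mkLinearMap p.primeCompl M y ∈ Submodule.localized'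
    (Localization.AtPrime p) p.primeCompl (LocalizedModule.mkLinearMap p.primeCompl M)
      (Submodule.span R (Set.range m)) := h ▸ Submodule.mem_top
  obtain ⟨z, hz, s, hs⟩ := hy
  rw [IsLocalizedModule.mk'_eq_iff, Submonoid.smul_def, ← map_smul,
    IsLocalizedModule.eq_iff_exists p.primeCompl] at hs
  obtain ⟨u, hu⟩ := hs
  refine ⟨u * s, (u * s).2, ?_⟩
  rw [mul_smul]
  simp only [Submonoid.smul_def] at hu
  rw [← hu]
  exact Submodule.smul_mem _ _ hz

/-- A family of r spanning vectors in a free module of rank r is independent, so a relation among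
them vanishes in the localization. -/
theorem exists_smul_eq_zero_of_linearCombination_eq_zero {r : ℕ} (p : Ideal R) [p.IsPrime]
    [Module.Finite R M]
    [Module.Free (Localization.AtPrime p) (LocalizedModule p.primeCompl M)]
    (hr : Module.finrank (Localization.AtPrime p) (LocalizedModule p.primeCompl M) = r)
    (m : Fin r → M) (h : Submodule.span (Localization.AtPrime p)
      (Set.range (LocalizedModule.mkLinearMap p.primeCompl M ∘ m)) = ⊤) (z : Fin r → R)
    (hz : Fintype.linearCombination R m z = 0) (i : Fin r) : ∃ s ∉ p, s * z i = 0 := by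
  have : Module.Finite (Localization.AtPrime p) (LocalizedModule p.primeCompl M) :=
    Module.Finite.of_isLocalizedModule p.primeCompl (LocalizedModule.mkLinearMap p.primeCompl M)
  let e := (Module.finBasisOfFinrankEq (Localization.AtPrime p)
    (LocalizedModule p.primeCompl M) hr).equivFun
  set f := LocalizedModule.mkLinearMap p.primeCompl M with hf
  have hsurj : Function.Surjective (e.toLinearMap ∘ₗ
      Fintype.linearCombination (Localization.AtPrime p) (f ∘ m)) := by
    refine e.surjective.comp ?_
    rw [← LinearMap.range_eq_top, Fintype.range_linearCombination, h]
  have hinj := OrzechProperty.injective_of_surjective_endomorphism _ hsurj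
  have h0 : (fun j => algebraMap R (Localization.AtPrime p) (z j)) = 0 := by
    apply hinj
    rw [map_zero, LinearMap.comp_apply, Fintype.linearCombination_apply]
    simp only [algebraMap_smul, Function.comp_apply, ← map_smul, ← map_sum]
    rw [← Fintype.linearCombination_apply, hz, map_zero, map_zero]
  obtain ⟨s, hs⟩ := (IsLocalization.map_eq_zero_iff p.primeCompl _ _).mp (congrFun h0 i)
  exact ⟨s, s.2, hs⟩

theorem genericallyFree_of_hasModuleRank [IsNoetherianRing R] [Module.Finite R M] {r : ℕ}
    (h : HasModuleRank R M r)
    (hinc : ∀ p ∈ associatedPrimes R R, ∀ q ∈ associatedPrimes R R, p ≤ q → p = q) :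
    GenericallyFree R M r := by
  have hfin := associatedPrimes.finite R R
  obtain ⟨m, hm⟩ := exists_span_mkLinearMap_eq_top_of_finset (M := M) (r := r) hfin.toFinset
    (fun p hp => (hfin.mem_toFinset.mp hp).isPrime)
    (fun p hp q hq => hinc p (hfin.mem_toFinset.mp hp) q (hfin.mem_toFinset.mp hq))
    (fun p hp _ => have := (h p (hfin.mem_toFinset.mp hp)).1
      exists_span_mkLinearMap_eq_top p (h p (hfin.mem_toFinset.mp hp)).2)
  have hinj : Function.Injective (Fintype.linearCombination R m) := by
    rw [injective_iff_map_eq_zero]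
    intro z hz
    by_contra hne
    obtain ⟨i, hi⟩ := Function.ne_iff.mp hne
    -- An associated prime containing the annihilator of a nonzero coordinate of the relation; yet
    -- that coordinate is killed by an element outside the prime.
    obtain ⟨p, hp, hle⟩ := exists_le_isAssociatedPrime_of_isNoetherianRing R (z i) hi
    have := hp.isPrime
    have := (h p hp).1
    obtain ⟨s, hs, hsz⟩ := exists_smul_eq_zero_of_linearCombination_eq_zero p (h p hp).2 m
      (hm p (hfin.mem_toFinset.mpr hp)) z hz i
    exact hs (hle (by rwa [Submodule.mem_colon_singleton, Submodule.mem_bot]))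
  let J : Ideal R := Module.annihilator R (M ⧸ LinearMap.range (Fintype.linearCombination R m))
  -- By prime avoidance, an ideal without nonzerodivisors lies in one associated prime, but the
  -- cokernel vanishes at each of them.
  have hJ : ¬ Disjoint (J : Set R) (nonZeroDivisors R) := by
    intro hd
    obtain ⟨p, hp, hle⟩ : ∃ p ∈ associatedPrimes R R, J ≤ p :=
      (J.subset_union_prime_finite hfin (f := id) 0 0 fun _ h _ _ => h.1).1 <|
        biUnion_associatedPrimes_eq_compl_nonZeroDivisors R ▸ hd.subset_compl_right
    have := hp.isPrime
    have hsub : Subsingleton (LocalizedModule p.primeCompl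
        (M ⧸ LinearMap.range (Fintype.linearCombination R m))) := by
      rw [LocalizedModule.subsingleton_iff]
      intro y
      obtain ⟨y, rfl⟩ := Submodule.Quotient.mk_surjective _ y
      obtain ⟨s, hs, hsy⟩ := exists_smul_mem_span_of_span_mkLinearMap_eq_top p m
        (hm p (hfin.mem_toFinset.mpr hp)) y
      refine ⟨s, hs, ?_⟩
      rwa [← Submodule.Quotient.mk_smul, Submodule.Quotient.mk_eq_zero,
        Fintype.range_linearCombination]
    exact (Module.notMem_support_iff (p := ⟨p, this⟩)).mpr hsub
      (Module.mem_support_iff_of_finite.mpr hle)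
  obtain ⟨c, hc1, hc2⟩ := Set.not_disjoint_iff.mp hJ
  have hc : ∀ y, c • y ∈ LinearMap.range (Fintype.linearCombination R m) := by
    intro y
    have := Module.mem_annihilator.mp hc1 (Submodule.Quotient.mk y)
    rwa [← Submodule.Quotient.mk_smul, Submodule.Quotient.mk_eq_zero] at this
  obtain ⟨k, hk⟩ := exists_comp_eq_of_range_le (Fintype.linearCombination R m) hinj
    (c • (LinearMap.id : M →ₗ[R] M)) hc
  refine ⟨c, hc2, _, k, hk, ?_⟩
  ext1 z
  refine LinearMap.ext fun y => hinj ?_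
  have := LinearMap.congr_fun hk (Fintype.linearCombination R m (LinearMap.single R (fun _ => R) z y))
  simp only [LinearMap.comp_apply, LinearMap.smul_apply, LinearMap.id_apply, map_smul] at this ⊢
  exact this

end Rank

/-! ### Depth zero versus depth one -/

section Depth

variable {R : Type*} [CommRing R] [IsLocalRing R]

theorem free_of_maximalIdeal_mem_associatedPrimes {M : Type*} [AddCommGroup M] [Module R M]
    [Module.Finite R M] {r : ℕ} (h : HasModuleRank R M r)
    (hm : IsLocalRing.maximalIdeal R ∈ associatedPrimes R R) : Module.Free R M := by
  have : Module.Flat R M := by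
    refine Module.flat_of_localized_maximal M fun P hP => ?_
    obtain rfl := IsLocalRing.eq_maximalIdeal hP
    have := (h _ hm).1
    exact Module.Flat.trans R (Localization.AtPrime (IsLocalRing.maximalIdeal R)) _
  exact Module.free_of_flat_of_isLocalRing

theorem exists_mem_nonZeroDivisors_of_maximalIdeal_notMem_associatedPrimes [IsNoetherianRing R]
    (hm : IsLocalRing.maximalIdeal R ∉ associatedPrimes R R) :
    ∃ c ∈ IsLocalRing.maximalIdeal R, c ∈ nonZeroDivisors R := by
  by_contra! hcon
  obtain ⟨p, hp, hle⟩ : ∃ p ∈ associatedPrimes R R, IsLocalRing.maximalIdeal R ≤ p :=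
    ((IsLocalRing.maximalIdeal R).subset_union_prime_finite (associatedPrimes.finite R R)
      (f := id) 0 0 fun _ h _ _ => h.1).1 <|
      biUnion_associatedPrimes_eq_compl_nonZeroDivisors R ▸ hcon
  have hp' := hp.isPrime
  exact hm ((IsLocalRing.maximalIdeal.isMaximal R).eq_of_le hp'.ne_top hle ▸ hp)

theorem associatedPrimes_eq_of_le [Ring.KrullDimLE 1 R]
    (hm : IsLocalRing.maximalIdeal R ∉ associatedPrimes R R) :
    ∀ p ∈ associatedPrimes R R, ∀ q ∈ associatedPrimes R R, p ≤ q → p = q := by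
  intro p hp q hq hpq
  have := hp.isPrime
  have := hq.isPrime
  rcases Ring.krullDimLE_one_iff.mp ‹_› q ‹_› with h | h
  · exact le_antisymm hpq (h.2 ⟨‹_›, bot_le⟩ hpq)
  · rw [IsLocalRing.eq_maximalIdeal h] at hq
    exact absurd hq hm

end Depth

/-! ### Splitting off free summands -/

section Splitting

variable {R : Type*} [CommRing R] {M N : Type*} [AddCommGroup M] [Module R M]
  [AddCommGroup N] [Module R N]

theorem isTorsionFree_of_injective (f : M →ₗ[R] N) (hf : Function.Injective f)
    (h : Module.IsTorsionFree R N) : Module.IsTorsionFree R M where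
  isSMulRegular c hc x y hxy := hf <| h.isSMulRegular hc <| by
    simpa using congrArg f hxy

/-- A free direct summand of rank one lowers the rank of the complement by one. -/
theorem HasModuleRank.of_linearEquiv_prod [Module.Finite R N] {r : ℕ}
    (h : HasModuleRank R M (r + 1)) (e : M ≃ₗ[R] R × N) : HasModuleRank R N r := by
  intro p _ hp
  obtain ⟨h1, h2⟩ := h p hp
  let Rp := Localization.AtPrime p
  let E : LocalizedModule p.primeCompl M ≃ₗ[Rp] Rp × LocalizedModule p.primeCompl N :=
    (LocalizedModule.equivTensorProduct p.primeCompl M).trans <|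
      (e.baseChange R Rp M (R × N)).trans <|
      (TensorProduct.prodRight R Rp Rp R N).trans <|
      LinearEquiv.prodCongr (TensorProduct.AlgebraTensorModule.rid R Rp Rp)
        (LocalizedModule.equivTensorProduct p.primeCompl N).symm
  have : Module.Finite Rp (LocalizedModule p.primeCompl N) :=
    Module.Finite.of_isLocalizedModule p.primeCompl (LocalizedModule.mkLinearMap p.primeCompl N)
  have : Module.Free Rp (Rp × LocalizedModule p.primeCompl N) := Module.Free.of_equiv E
  have : Module.Projective Rp (LocalizedModule p.primeCompl N) :=
    Module.Projective.of_split (LinearMap.inr Rp Rp _) (LinearMap.snd Rp Rp _)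
      (LinearMap.snd_comp_inr _ _ _)
  have hfree : Module.Free Rp (LocalizedModule p.primeCompl N) :=
    Module.free_of_flat_of_isLocalRing
  refine ⟨hfree, ?_⟩
  have h3 := E.finrank_eq
  rw [h2, Module.finrank_prod, Module.finrank_self] at h3
  change Module.finrank Rp _ = r
  omega

theorem subsingleton_of_genericallyFree_zero (h : GenericallyFree R M 0)
    (htf : Module.IsTorsionFree R M) : Subsingleton M := by
  obtain ⟨c, hc, α, β, h1, -⟩ := h
  refine ⟨fun x y => htf.isSMulRegular (isRegular_iff_mem_nonZeroDivisors.mpr hc) ?_⟩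
  have h2 := LinearMap.congr_fun h1 x
  have h3 := LinearMap.congr_fun h1 y
  simp only [LinearMap.comp_apply, LinearMap.smul_apply, LinearMap.id_apply] at h2 h3
  change c • x = c • y
  rw [← h2, ← h3, Subsingleton.elim (β x) (β y)]

theorem exists_apply_eq_one_of_traceIdeal_eq_top [IsLocalRing R] (h : traceIdeal R M = ⊤) :
    ∃ (f : Module.Dual R M) (y : M), f y = 1 := by
  suffices hu : ∃ (f : Module.Dual R M) (y : M), IsUnit (f y) by
    obtain ⟨f, y, u, hu⟩ := hu
    refine ⟨f, (↑u⁻¹ : R) • y, ?_⟩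
    rw [map_smul, ← hu, smul_eq_mul, Units.inv_mul]
  by_contra! hcon
  have hle : traceIdeal R M ≤ IsLocalRing.maximalIdeal R := by
    rintro _ ⟨z, rfl⟩
    induction z with
    | zero => simp
    | add x y hx hy => rw [map_add]; exact Ideal.add_mem _ hx hy
    | tmul f y => rw [contractLeft_apply]; exact hcon f y
  exact (IsLocalRing.maximalIdeal.isMaximal R).ne_top (top_le_iff.mp (h ▸ hle))

theorem nonempty_linearEquiv_prod_ker (f : Module.Dual R M) (y : M) (hy : f y = 1) :
    Nonempty (M ≃ₗ[R] R × LinearMap.ker f) := by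
  let π : M →ₗ[R] LinearMap.ker f :=
    (LinearMap.id - f.smulRight y).codRestrict _ fun z => by simp [hy]
  have hπ : ∀ z, (π z : M) = z - f z • y := fun z => rfl
  refine ⟨LinearEquiv.ofLinearMap (f.prod π)
    ((LinearMap.toSpanSingleton R M y).coprod (LinearMap.ker f).subtype) ?_ ?_⟩
  · ext x <;> simp [hπ, hy]
  · ext x
    simp [hπ]

theorem isTorsionFree_of_linearEquiv_prod (e : M ≃ₗ[R] R × N)
    (htf : Module.IsTorsionFree R (M ⊗[R] Module.Dual R M)) : Module.IsTorsionFree R N := by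
  let s : M := e.symm (1, 0)
  -- N embeds by y ↦ y ⊗ pr₁, with retraction z ⊗ φ ↦ φ(s)·pr₂(z); here pr₁(s) = 1.
  let i : N →ₗ[R] M ⊗[R] Module.Dual R M :=
    (TensorProduct.mk R M (Module.Dual R M)).flip (LinearMap.fst R R N ∘ₗ e.toLinearMap) ∘ₗ
      e.symm.toLinearMap ∘ₗ LinearMap.inr R R N
  let p : M ⊗[R] Module.Dual R M →ₗ[R] N :=
    TensorProduct.lift ((LinearMap.lsmul R N).flip.compl₂ (Module.Dual.eval R M s) ∘ₗ
      LinearMap.snd R R N ∘ₗ e.toLinearMap)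
  refine isTorsionFree_of_injective i (Function.LeftInverse.injective (g := p) fun x => ?_) htf
  simp [p, i, s]

theorem isTorsionFree_tensor_dual_of_linearEquiv_prod (e : M ≃ₗ[R] R × N)
    (htf : Module.IsTorsionFree R (M ⊗[R] Module.Dual R M)) :
    Module.IsTorsionFree R (N ⊗[R] Module.Dual R N) := by
  let ι : N →ₗ[R] M := e.symm.toLinearMap ∘ₗ LinearMap.inr R R N
  let π : M →ₗ[R] N := LinearMap.snd R R N ∘ₗ e.toLinearMap
  have h : π ∘ₗ ι = LinearMap.id := by
    ext x
    simp [π, ι]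
  refine isTorsionFree_of_injective (TensorProduct.map ι π.dualMap)
    (Function.LeftInverse.injective (g := TensorProduct.map π ι.dualMap) fun x => ?_) htf
  have h' : ι.dualMap ∘ₗ π.dualMap = LinearMap.id := by
    rw [LinearMap.dualMap_comp_dualMap, h, LinearMap.dualMap_id]
  rw [← LinearMap.comp_apply, ← TensorProduct.map_comp, h, h', TensorProduct.map_id,
    LinearMap.id_apply]

end Splitting

section Reduction

universe u v

variable {R : Type u} [CommRing R] [IsNoetherianRing R] [IsLocalRing R]

/-- Splitting off free summands reduces the freeness of `M` to the case of a proper trace ideal. -/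
theorem free_of_free_of_traceIdeal_le
    (hinc : ∀ p ∈ associatedPrimes R R, ∀ q ∈ associatedPrimes R R, p ≤ q → p = q)
    (H : ∀ (M : Type v) [AddCommGroup M] [Module R M] [Module.Finite R M] (r : ℕ),
      HasModuleRank R M r → 0 < r → Module.IsTorsionFree R (M ⊗[R] Module.Dual R M) →
      traceIdeal R M ≤ IsLocalRing.maximalIdeal R → Module.Free R M) (r : ℕ) :
    ∀ (M : Type v) [AddCommGroup M] [Module R M] [Module.Finite R M],
      HasModuleRank R M r → (0 < r ∨ Subsingleton M) →
      Module.IsTorsionFree R (M ⊗[R] Module.Dual R M) → Module.Free R M := by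
  induction r with
  | zero =>
    intro M _ _ _ _ h _
    have : Subsingleton M := h.resolve_left (lt_irrefl 0)
    exact Module.Free.of_subsingleton R M
  | succ r ih =>
    intro M _ _ _ hM _ htf
    by_cases ht : traceIdeal R M = ⊤
    · obtain ⟨f, y, hy⟩ := exists_apply_eq_one_of_traceIdeal_eq_top ht
      obtain ⟨e⟩ := nonempty_linearEquiv_prod_ker f y hy
      have hK := hM.of_linearEquiv_prod e
      have hfree : Module.Free R (LinearMap.ker f) := by
        refine ih _ hK ?_ (isTorsionFree_tensor_dual_of_linearEquiv_prod e htf)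
        -- A complement of rank zero is torsion, and it is torsionfree as a submodule of M ⊗ M*, so
        -- it vanishes.
        rcases Nat.eq_zero_or_pos r with rfl | hr
        · exact Or.inr (subsingleton_of_genericallyFree_zero
            (genericallyFree_of_hasModuleRank hK hinc) (isTorsionFree_of_linearEquiv_prod e htf))
        · exact Or.inl hr
      exact Module.Free.of_equiv e.symm
    · exact H M (r + 1) hM r.succ_pos htf (IsLocalRing.le_maximalIdeal ht)

end Reduction

/-! ### Part 1: the trace ideal inside a power of 𝔪 -/

section PowersOfMaximalIdeal

variable {R : Type*} [CommRing R] [IsNoetherianRing R] [IsLocalRing R] [Ring.KrullDimLE 1 R]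

theorem free_of_traceIdeal_le_pow {M : Type*} [AddCommGroup M] [Module R M] [Module.Finite R M]
    {r : ℕ} (hM : GenericallyFree R M r) (hr : 0 < r)
    (htf : Module.IsTorsionFree R (M ⊗[R] Module.Dual R M)) {c : R}
    (hcm : c ∈ IsLocalRing.maximalIdeal R) (hc : c ∈ nonZeroDivisors R) (x : R) (n : ℕ)
    (htr : traceIdeal R M ≤ IsLocalRing.maximalIdeal R ^ n)
    (hx : Ideal.span {x} * IsLocalRing.maximalIdeal R ^ n = IsLocalRing.maximalIdeal R ^ (n + 1)) :
    Module.Free R M := by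
  have hle : IsLocalRing.maximalIdeal R ^ (n + 1) ≤ Ideal.span {x} := hx ▸ Ideal.mul_le_left
  refine free_of_mul_traceIdeal_le (A := R) hM hr htf x ?_ (pow_mem hc (n + 1))
    (hle (Ideal.pow_mem_pow hcm _)) fun a ha t ht => hle ?_
  -- If x were a unit, then 𝔪^n = 𝔪^(n+1), so 𝔪^n = 0 by Nakayama, although it contains the
  -- nonzerodivisor c^n.
  · intro hu
    rw [Ideal.span_singleton_eq_top.mpr hu, Ideal.top_mul, pow_succ'] at hx
    have hbot := Submodule.eq_bot_of_le_smul_of_le_jacobson_bot _ _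
      (IsNoetherian.noetherian (IsLocalRing.maximalIdeal R ^ n)) hx.le
      (IsLocalRing.maximalIdeal_le_jacobson _)
    have h0 : c ^ n ∈ (⊥ : Ideal R) := hbot ▸ Ideal.pow_mem_pow hcm n
    exact nonZeroDivisors.ne_zero (pow_mem hc n) h0
  · rw [pow_succ']
    exact Ideal.mul_mem_mul ha (htr ht)

end PowersOfMaximalIdeal

/-! ### Colon ideals of large powers -/

section RatliffRush

variable {R : Type*} [CommRing R] [IsNoetherianRing R]

/-- If `I` contains a nonzerodivisor, then `I ^ (n + 1) : I = I ^ n` for all large `n`. -/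
theorem exists_forall_mem_pow_of_mul_mem_pow_succ (I : Ideal R) {c : R} (hcI : c ∈ I)
    (hc : c ∈ nonZeroDivisors R) :
    ∃ k : ℕ, ∀ n ≥ k, ∀ a : R, (∀ y ∈ I, a * y ∈ I ^ (n + 1)) → a ∈ I ^ n := by
  obtain ⟨s, g, hg⟩ := Submodule.fg_iff_exists_fin_generating_family.mp
    (IsNoetherian.noetherian I)
  have hgI : ∀ i, g i ∈ I := fun i => hg ▸ Submodule.subset_span ⟨i, rfl⟩
  let D : R →ₗ[R] (Fin s → R) := LinearMap.toSpanSingleton R (Fin s → R) g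
  have hDinj : Function.Injective D := by
    rw [injective_iff_map_eq_zero]
    intro a ha
    have hle : I ≤ LinearMap.ker (LinearMap.mulLeft R a) := by
      rw [← hg, Submodule.span_le]
      rintro _ ⟨i, rfl⟩
      exact congrFun ha i
    exact (mem_nonZeroDivisors_iff.mp hc).2 a (hle hcI)
  have hcoord : ∀ (J : Ideal R) (z : Fin s → R), z ∈ J • (⊤ : Submodule R (Fin s → R)) →
      ∀ i, z i ∈ J := by
    intro J z hz i
    have h1 : (LinearMap.proj i : (Fin s → R) →ₗ[R] R) z ∈
        (J • (⊤ : Submodule R (Fin s → R))).map (LinearMap.proj i) := ⟨z, hz, rfl⟩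
    rw [Submodule.map_smul''] at h1
    exact Ideal.mul_le_left h1
  have hcoord' : ∀ (J : Ideal R) (z : Fin s → R), (∀ i, z i ∈ J) →
      z ∈ J • (⊤ : Submodule R (Fin s → R)) := by
    intro J z hz
    rw [pi_eq_sum_univ' z]
    exact Submodule.sum_mem _ fun i _ => Submodule.smul_mem_smul (hz i) Submodule.mem_top
  obtain ⟨k, hk⟩ := I.exists_pow_inf_eq_pow_smul (LinearMap.range D)
  -- Here k comes from Artin–Rees for the image of D, and K is the preimage of I^k·R^s under D.
  let K : Ideal R := (I ^ k).colon (I : Set R)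
  have hK : I ^ k • (⊤ : Submodule R (Fin s → R)) ⊓ LinearMap.range D ≤ Submodule.map D K := by
    rintro _ ⟨hz, a, rfl⟩
    refine ⟨a, ?_, rfl⟩
    have hle : Submodule.span R (Set.range g) ≤
        Submodule.comap (LinearMap.mulLeft R a) (I ^ k) := by
      rw [Submodule.span_le]
      rintro _ ⟨i, rfl⟩
      exact hcoord _ _ hz i
    exact Submodule.mem_colon.mpr fun y hy => hle (hg.symm ▸ hy)
  refine ⟨k, fun n hn a ha => ?_⟩
  have h1 : D a ∈ I ^ (n + 1) • (⊤ : Submodule R (Fin s → R)) ⊓ LinearMap.range D :=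
    ⟨hcoord' _ _ fun i => ha _ (hgI i), a, rfl⟩
  rw [hk (n + 1) (by omega)] at h1
  have h2 := Submodule.smul_mono le_rfl hK h1
  rw [← Submodule.map_smul''] at h2
  obtain ⟨a', ha', haa⟩ := h2
  obtain rfl := hDinj haa
  -- One of the n + 1 - k factors I is spent on I·K ⊆ I^k.
  have h3 : I ^ (n + 1 - k) • K ≤ I ^ n := by
    have : n + 1 - k = (n - k) + 1 := by omega
    rw [this, pow_succ, smul_eq_mul, mul_assoc]
    have h4 : I * K ≤ I ^ k := Ideal.mul_le.mpr fun y hy b hb => by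
      rw [mul_comm]
      exact Submodule.mem_colon.mp hb y hy
    calc I ^ (n - k) * (I * K) ≤ I ^ (n - k) * I ^ k := Ideal.mul_mono_right h4
      _ = I ^ n := by rw [← pow_add]; congr 1; omega
  exact h3 ha'

end RatliffRush

/-! ### A generic element of an ideal -/

section GenericElement

open Polynomial

variable {R : Type*} [CommRing R]

/-- A McCoy-type argument: multiplication by a polynomial whose coefficients detect membership in
powers of `I` is injective on the associated graded ring in large degrees. -/
theorem coeff_mem_pow_of_mul_coeff_mem_pow {I : Ideal R} {x : R[X]} (hx : ∀ i, x.coeff i ∈ I)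
    {k : ℕ} (hk : ∀ n ≥ k, ∀ a : R, (∀ i, a * x.coeff i ∈ I ^ (n + 1)) → a ∈ I ^ n) (d : ℕ) :
    ∀ n ≥ k, ∀ w : R[X], (∀ l ≥ d, w.coeff l = 0) → (∀ l, w.coeff l ∈ I ^ n) →
      (∀ l, (x * w).coeff l ∈ I ^ (n + 2)) → ∀ l, w.coeff l ∈ I ^ (n + 1) := by
  induction d with
  | zero =>
    intro n _ w hw _ _ l
    rw [hw l (Nat.zero_le l)]
    exact zero_mem _
  | succ d ih =>
    intro n hn w hdeg hw hxw
    -- Descending induction on i, with j as counter: each coefficient of x multiplies all of w into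
    -- I^(n+2).
    have key : ∀ j i, x.natDegree < i + j → ∀ l, x.coeff i * w.coeff l ∈ I ^ (n + 2) := by
      intro j
      induction j with
      | zero =>
        intro i hi l
        rw [coeff_eq_zero_of_natDegree_lt (by omega), zero_mul]
        exact zero_mem _
      | succ j ihj =>
        intro i hi
        -- In the coefficient of x * w at i + d, terms with smaller x-index vanish by the degree
        -- bound on w, and those with larger x-index are covered by `ihj`.
        have hlead : x.coeff i * w.coeff d ∈ I ^ (n + 2) := by
          have h1 := hxw (i + d)
          rw [coeff_mul, ← Finset.add_sum_erase _ _
            (Finset.HasAntidiagonal.mem_antidiagonal.mpr (rfl : (i, d).1 + (i, d).2 = i + d))] at h1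
          refine (Ideal.add_mem_iff_left _ (Ideal.sum_mem _ fun ab hab => ?_)).mp h1
          rw [Finset.mem_erase, Finset.HasAntidiagonal.mem_antidiagonal] at hab
          obtain ⟨hne, hab⟩ := hab
          rcases lt_trichotomy ab.1 i with h | h | h
          · rw [hdeg ab.2 (by omega), mul_zero]
            exact zero_mem _
          · exact absurd (Prod.ext h (by omega)) hne
          · exact ihj ab.1 (by omega) ab.2
        -- Removing the top term of w lowers the degree, while the factor `x.coeff i` raises the
        -- power of I by one.
        have hIH := ih (n + 1) (by omega) (C (x.coeff i) * w.erase d) ?_ ?_ ?_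
        · intro l
          rcases eq_or_ne l d with rfl | hl
          · exact hlead
          · have := hIH l
            rwa [coeff_C_mul, erase_ne _ hl] at this
        · intro l hl
          rw [coeff_C_mul]
          rcases eq_or_ne l d with rfl | hl'
          · rw [erase_same, mul_zero]
          · rw [erase_ne _ hl', hdeg l (by omega), mul_zero]
        · intro l
          rw [coeff_C_mul, pow_succ']
          rcases eq_or_ne l d with rfl | hl'
          · rw [erase_same, mul_zero]
            exact zero_mem _
          · rw [erase_ne _ hl']
            exact Ideal.mul_mem_mul (hx i) (hw l)
        · have hsplit : x * (C (x.coeff i) * w.erase d) =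
              C (x.coeff i) * (x * w) - x * monomial d (x.coeff i * w.coeff d) := by
            conv_rhs => rw [← monomial_add_erase w d]
            rw [coeff_add, coeff_monomial, if_pos rfl, erase_same, add_zero, ← C_mul_monomial]
            ring
          intro l
          rw [hsplit, coeff_sub, coeff_C_mul, pow_succ']
          refine Ideal.sub_mem _ (Ideal.mul_mem_mul (hx i) (hxw l)) ?_
          rw [coeff_mul]
          refine Ideal.sum_mem _ fun ab _ => Ideal.mul_mem_mul (hx _) ?_
          rw [coeff_monomial]
          split_ifs
          · exact hlead
          · exact zero_mem _
    intro l
    refine hk (n + 1) (by omega) _ fun i => ?_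
    rw [mul_comm]
    exact key (x.natDegree + 1) i (by omega) l

/-- A polynomial whose coefficients generate the ideal `I`. -/
theorem exists_polynomial_of_fg {I : Ideal R} (hI : I.FG) :
    ∃ x : R[X], (∀ i, x.coeff i ∈ I) ∧
      ∀ (J : Ideal R) (a : R), (∀ i, a * x.coeff i ∈ J) → ∀ y ∈ I, a * y ∈ J := by
  obtain ⟨s, g, hg⟩ := Submodule.fg_iff_exists_fin_generating_family.mp hI
  have hcoeff : ∀ i, (∑ j : Fin s, monomial (j : ℕ) (g j)).coeff i =
      ∑ j : Fin s, if (j : ℕ) = i then g j else 0 := by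
    intro i
    simp [coeff_monomial]
  refine ⟨∑ j : Fin s, monomial (j : ℕ) (g j), fun i => ?_, fun J a ha y hy => ?_⟩
  · rw [hcoeff]
    refine Ideal.sum_mem _ fun j _ => ?_
    split_ifs
    · exact hg ▸ Submodule.subset_span ⟨j, rfl⟩
    · exact zero_mem _
  · have hle : I ≤ Submodule.comap (LinearMap.mulLeft R a) J := by
      rw [← hg, Submodule.span_le]
      rintro _ ⟨i, rfl⟩
      have := ha i
      rw [hcoeff, Finset.sum_eq_single i (fun j _ hj => if_neg fun h => hj (Fin.ext h))
        (fun h => absurd (Finset.mem_univ i) h), if_pos rfl] at this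
      exact this
    exact hle hy

end GenericElement

/-! ### Minimal generators and Hilbert function increments -/

section MinimalGenerators

variable {R : Type*} [CommRing R] [IsNoetherianRing R] [IsLocalRing R]

/-- The minimal number of generators of an ideal. -/
noncomputable def minGenerators (I : Ideal R) : ℕ :=
  Module.finrank (IsLocalRing.ResidueField R) (IsLocalRing.ResidueField R ⊗[R] I)

/-- The generators lift a basis of I/𝔪I; the second clause is the independence of that basis. -/
theorem exists_minimal_generators (I : Ideal R) :
    ∃ u : Fin (minGenerators I) → R, Submodule.span R (Set.range u) = I ∧
      ∀ w : Fin (minGenerators I) → R, ∑ j, w j * u j ∈ IsLocalRing.maximalIdeal R * I →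
        ∀ j, w j ∈ IsLocalRing.maximalIdeal R := by
  let b : Module.Basis (Fin (minGenerators I)) (IsLocalRing.ResidueField R)
      (IsLocalRing.ResidueField R ⊗[R] I) :=
    Module.finBasis (IsLocalRing.ResidueField R) (IsLocalRing.ResidueField R ⊗[R] I)
  obtain ⟨v, hv⟩ := (TensorProduct.mk_surjective R I (IsLocalRing.ResidueField R)
    IsLocalRing.residue_surjective).comp_left b
  have hv' : ∀ j, (1 : IsLocalRing.ResidueField R) ⊗ₜ[R] v j = b j := fun j => congrFun hv j
  have hspan := IsLocalRing.span_eq_top_of_tmul_eq_basis v b hv'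
  refine ⟨fun j => v j, ?_, fun w hw j => ?_⟩
  · have := congrArg (Submodule.map (Submodule.subtype I)) hspan
    rw [Submodule.map_span, ← Set.range_comp, Submodule.map_top, Submodule.range_subtype] at this
    exact this
  · have h1 : ∑ j, w j • v j ∈ IsLocalRing.maximalIdeal R • (⊤ : Submodule R I) := by
      rw [Submodule.mem_smul_top_iff]
      simpa using hw
    have h2 : ∀ z ∈ IsLocalRing.maximalIdeal R • (⊤ : Submodule R I),
        (1 : IsLocalRing.ResidueField R) ⊗ₜ[R] z = 0 := by
      intro z hz
      induction hz using Submodule.smul_induction_on' with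
      | smul a ha y _ =>
        have h0 : a • (1 : IsLocalRing.ResidueField R) = 0 := by
          rw [Algebra.smul_def, mul_one]
          exact (IsLocalRing.residue_eq_zero_iff a).mpr ha
        rw [← TensorProduct.smul_tmul, h0, TensorProduct.zero_tmul]
      | add y _ z _ hy hz => rw [TensorProduct.tmul_add, hy, hz, add_zero]
    have h3 := h2 _ h1
    rw [TensorProduct.tmul_sum] at h3
    have h4 : ∑ j, IsLocalRing.residue R (w j) • b j = 0 := by
      rw [← h3]
      refine Finset.sum_congr rfl fun j _ => ?_
      rw [TensorProduct.tmul_smul, hv']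
      exact algebraMap_smul (IsLocalRing.ResidueField R) (w j) (b j)
    exact (IsLocalRing.residue_eq_zero_iff _).mp
      (Fintype.linearIndependent_iff.mp b.linearIndependent _ h4 j)

theorem length_quotient_maximalIdeal_mul (I : Ideal R) :
    Module.length R (R ⧸ IsLocalRing.maximalIdeal R * I) =
      Module.length R (R ⧸ I) + minGenerators I := by
  have h1 : cokerLength (IsLocalRing.maximalIdeal R • (⊤ : Submodule R I)).subtype =
      minGenerators I := by
    rw [cokerLength, Submodule.range_subtype, minGenerators, ← Module.length_eq_finrank,
      ← Module.length_eq_of_surjective (S := R) IsLocalRing.residue_surjective]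
    exact (TensorProduct.quotTensorEquivQuotSMul I (IsLocalRing.maximalIdeal R)).symm.length_eq
  have h2 := cokerLength_comp (IsLocalRing.maximalIdeal R • (⊤ : Submodule R I)).subtype
    (Submodule.subtype I) I.subtype_injective
  rw [h1, cokerLength, cokerLength, LinearMap.range_comp, Submodule.range_subtype,
    Submodule.range_subtype, Submodule.map_smul'', Submodule.map_top, Submodule.range_subtype] at h2
  rw [add_comm]
  exact h2

theorem embDim_eq_minGenerators : embDim R = minGenerators (IsLocalRing.maximalIdeal R) := by
  have h : (embDim R : ℕ∞) = minGenerators (IsLocalRing.maximalIdeal R) := by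
    rw [embDim, minGenerators, ← Module.length_eq_finrank, ← Module.length_eq_finrank,
      ← Module.length_eq_of_surjective (S := R) IsLocalRing.residue_surjective,
      ← Module.length_eq_of_surjective (S := R) IsLocalRing.residue_surjective]
    exact (TensorProduct.quotTensorEquivQuotSMul (IsLocalRing.maximalIdeal R)
      (IsLocalRing.maximalIdeal R)).symm.length_eq
  exact_mod_cast h

end MinimalGenerators

/-! ### Multiplication by the generic element on the graded ring -/

section Comparison

open Polynomial

variable {R : Type*} [CommRing R] [IsNoetherianRing R] [IsLocalRing R]

/-- Multiplication by a generic element of the maximal ideal, from degree `n` to degree `n + 1` of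
the associated graded ring. -/
theorem minGenerators_pow_le_and_exists {x : R[X]}
    (hx : ∀ i, x.coeff i ∈ IsLocalRing.maximalIdeal R) {k : ℕ}
    (hk : ∀ n ≥ k, ∀ a : R, (∀ i, a * x.coeff i ∈ IsLocalRing.maximalIdeal R ^ (n + 1)) →
      a ∈ IsLocalRing.maximalIdeal R ^ n) {n : ℕ} (hn : k ≤ n) :
    minGenerators (IsLocalRing.maximalIdeal R ^ n) ≤
        minGenerators (IsLocalRing.maximalIdeal R ^ (n + 1)) ∧
      (minGenerators (IsLocalRing.maximalIdeal R ^ n) =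
          minGenerators (IsLocalRing.maximalIdeal R ^ (n + 1)) →
        ∃ s : R[X], s.map (IsLocalRing.residue R) ≠ 0 ∧
          ∀ y ∈ IsLocalRing.maximalIdeal R ^ (n + 1),
            s * C y ∈ Ideal.span {x} * (IsLocalRing.maximalIdeal R ^ n).map C) := by
  obtain ⟨u, hu, hmin⟩ := exists_minimal_generators (IsLocalRing.maximalIdeal R ^ n)
  obtain ⟨v, hv, -⟩ := exists_minimal_generators (IsLocalRing.maximalIdeal R ^ (n + 1))
  generalize minGenerators (IsLocalRing.maximalIdeal R ^ n) = e at *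
  generalize minGenerators (IsLocalRing.maximalIdeal R ^ (n + 1)) = e' at *
  have hum : ∀ j, u j ∈ IsLocalRing.maximalIdeal R ^ n := fun j =>
    hu.le (Submodule.subset_span ⟨j, rfl⟩)
  have hvm : ∀ j, v j ∈ IsLocalRing.maximalIdeal R ^ (n + 1) := fun j =>
    hv.le (Submodule.subset_span ⟨j, rfl⟩)
  have hP : ∀ j, ∃ c : Fin e' → R[X], ∑ i, c i * C (v i) = x * C (u j) := by
    intro j
    have h1 : x * C (u j) ∈ (IsLocalRing.maximalIdeal R ^ (n + 1)).map C := by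
      rw [Ideal.mem_map_C_iff]
      intro l
      rw [coeff_mul_C, pow_succ']
      exact Ideal.mul_mem_mul (hx l) (hum j)
    rw [← hv, ← Ideal.span, Ideal.map_span, ← Set.range_comp,
      Ideal.mem_span_range_iff_exists_fun] at h1
    exact h1
  choose P hP using hP
  let Pm : Matrix (Fin e) (Fin e') R[X] := Matrix.of P
  let K := IsLocalRing.ResidueField R
  let ρ : R[X] →+* K[X] := mapRingHom (IsLocalRing.residue R)
  have hρ : Function.Surjective ρ := map_surjective _ IsLocalRing.residue_surjective
  have hρ0 : ∀ p : R[X], ρ p = 0 ↔ ∀ l, p.coeff l ∈ IsLocalRing.maximalIdeal R := by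
    intro p
    rw [Polynomial.ext_iff]
    refine forall_congr' fun l => ?_
    rw [coe_mapRingHom, coeff_map, coeff_zero, IsLocalRing.residue_eq_zero_iff]
  -- If w lifts z, then x · Σ w_j u_j has coefficients in 𝔪^(n+2), so Σ w_j u_j has them in 𝔪^(n+1),
  -- and minimality of u puts the coefficients of each w_j in 𝔪.
  have hinj : ∀ z : Fin e → K[X], Matrix.vecMul z (Pm.map ρ) = 0 → z = 0 := by
    intro z hz
    obtain ⟨w, rfl⟩ := hρ.comp_left z
    have h1 : ∀ i l, (∑ j, w j * P j i).coeff l ∈ IsLocalRing.maximalIdeal R := by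
      intro i
      rw [← hρ0, map_sum]
      simp only [map_mul]
      exact congrFun hz i
    have h2 : x * ∑ j, w j * C (u j) = ∑ i, (∑ j, w j * P j i) * C (v i) := by
      simp only [Finset.mul_sum, Finset.sum_mul]
      rw [Finset.sum_comm]
      refine Finset.sum_congr rfl fun j _ => ?_
      rw [mul_left_comm, ← hP j, Finset.mul_sum]
      exact Finset.sum_congr rfl fun i _ => by ring
    have h3 := coeff_mem_pow_of_mul_coeff_mem_pow hx hk ((∑ j, w j * C (u j)).natDegree + 1) n hn
      (∑ j, w j * C (u j)) (fun l hl => coeff_eq_zero_of_natDegree_lt (by omega)) ?_ ?_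
    · ext1 j
      change ρ (w j) = 0
      rw [hρ0]
      intro l
      refine hmin (fun j => (w j).coeff l) ?_ j
      have := h3 l
      simpa only [finsetSum_coeff, coeff_mul_C, pow_succ'] using this
    · intro l
      rw [finsetSum_coeff]
      exact Ideal.sum_mem _ fun j _ => by
        rw [coeff_mul_C]
        exact Ideal.mul_mem_left _ _ (hum j)
    · intro l
      rw [h2, finsetSum_coeff]
      refine Ideal.sum_mem _ fun i _ => ?_
      rw [coeff_mul_C, pow_succ']
      exact Ideal.mul_mem_mul (h1 i l) (hvm i)
  constructor
  · refine le_of_fin_injective K[X] (Matrix.vecMulLinear (Pm.map ρ)) ?_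
    rw [injective_iff_map_eq_zero]
    exact hinj
  · rintro rfl
    -- The determinant is nonzero over k[X] by injectivity, and the adjugate writes det · v_i as a
    -- combination of the x · u_j.
    refine ⟨Pm.det, ?_, fun y hy => ?_⟩
    · change ρ Pm.det ≠ 0
      rw [RingHom.map_det]
      intro h0
      obtain ⟨z, hz, hz0⟩ := Matrix.exists_vecMul_eq_zero_iff.mpr h0
      exact hz (hinj z hz0)
    · have h1 : ∀ i, Pm.det * C (v i) ∈
          Ideal.span {x} * (IsLocalRing.maximalIdeal R ^ n).map C := by
        intro i
        have h2 : Pm.mulVec (fun i => C (v i)) = fun j => x * C (u j) := funext fun j => hP j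
        have h3 := congrFun (congrArg (Matrix.mulVec Pm.adjugate) h2) i
        rw [Matrix.mulVec_mulVec, Matrix.adjugate_mul, Matrix.smul_mulVec, Matrix.one_mulVec,
          Pi.smul_apply, smul_eq_mul] at h3
        rw [h3, Matrix.mulVec, dotProduct]
        exact Ideal.sum_mem _ fun j _ => Ideal.mul_mem_left _ _ <|
          Ideal.mul_mem_mul (Ideal.mem_span_singleton_self x) (Ideal.mem_map_of_mem C (hum j))
      rw [← hv] at hy
      induction hy using Submodule.span_induction with
      | mem y hy =>
        obtain ⟨i, rfl⟩ := hy
        exact h1 i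
      | zero => simp
      | add y z _ _ hy hz =>
        rw [C_add, mul_add]
        exact Ideal.add_mem _ hy hz
      | smul a y _ hy =>
        rw [smul_eq_mul, C_mul, mul_left_comm]
        exact Ideal.mul_mem_left _ _ hy

end Comparison

/-! ### Specialising the variable in a finite free extension -/

section Extension

open Polynomial

variable {R : Type*} [CommRing R] [IsLocalRing R]

/-- A polynomial nonzero modulo the maximal ideal becomes, modulo that ideal, invertible in a
suitable finite free extension. -/
theorem exists_monic_isUnit_mk (s : R[X]) (hs : s.map (IsLocalRing.residue R) ≠ 0) :
    ∃ f t : R[X], f.Monic ∧ 0 < f.natDegree ∧ IsUnit (AdjoinRoot.mk f t) ∧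
      ∀ l, (s - t).coeff l ∈ IsLocalRing.maximalIdeal R := by
  -- Replacing s by a lift t of the same degree as its reduction makes the leading coefficient a
  -- unit.
  obtain ⟨t, ht1, ht2⟩ := exists_degree_eq_of_mem_lifts (f := IsLocalRing.residue R)
    (p := s.map (IsLocalRing.residue R)) ((mem_lifts _).mpr ⟨s, rfl⟩)
  replace ht2 := natDegree_eq_of_degree_eq ht2
  have hlead : IsUnit t.leadingCoeff := by
    rw [← IsLocalRing.notMem_maximalIdeal, ← IsLocalRing.residue_eq_zero_iff, leadingCoeff,
      ← coeff_map, ht1, ht2]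
    exact leadingCoeff_ne_zero.mpr hs
  obtain ⟨c, hc⟩ := hlead
  have ht0 : t ≠ 0 := by
    rintro rfl
    rw [Polynomial.map_zero] at ht1
    exact hs ht1.symm
  have hdeg : (1 : R[X]).degree < (t * X).degree := by
    rw [degree_mul_X, degree_one, degree_eq_natDegree ht0]
    exact_mod_cast Nat.succ_pos _
  have hcl : (↑c⁻¹ : R) * (t * X + 1).leadingCoeff = 1 := by
    rw [leadingCoeff_add_of_degree_lt' hdeg, leadingCoeff_mul_X, ← hc, Units.inv_mul]
  -- Modulo this monic f one has t · X = -1. The extra factor X keeps the degree positive even when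
  -- t is constant.
  refine ⟨C (↑c⁻¹ : R) * (t * X + 1), t, monic_C_mul_of_mul_leadingCoeff_eq_one hcl, ?_, ?_, ?_⟩
  · rw [natDegree_C_mul_of_mul_ne_zero (by rw [hcl]; exact one_ne_zero),
      natDegree_add_eq_left_of_degree_lt hdeg, natDegree_mul_X ht0]
    exact Nat.succ_pos _
  · have h1 : AdjoinRoot.mk (C (↑c⁻¹ : R) * (t * X + 1)) (t * X + 1) = 0 := by
      rw [AdjoinRoot.mk_eq_zero]
      refine ⟨C (c : R), ?_⟩
      rw [mul_right_comm, ← C_mul, Units.inv_mul, C_1, one_mul]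
    rw [map_add, map_mul, map_one] at h1
    refine IsUnit.of_mul_eq_one (-AdjoinRoot.mk _ X) ?_
    rw [mul_neg, eq_neg_of_add_eq_zero_left h1, neg_neg]
  · intro l
    rw [← IsLocalRing.residue_eq_zero_iff, ← coeff_map, Polynomial.map_sub, ht1, sub_self,
      coeff_zero]

theorem exists_monic_map_pow_succ_eq [IsNoetherianRing R] {x s : R[X]}
    (hx : ∀ i, x.coeff i ∈ IsLocalRing.maximalIdeal R)
    (hs : s.map (IsLocalRing.residue R) ≠ 0) {n : ℕ}
    (hsx : ∀ y ∈ IsLocalRing.maximalIdeal R ^ (n + 1),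
      s * C y ∈ Ideal.span {x} * (IsLocalRing.maximalIdeal R ^ n).map C) :
    ∃ f : R[X], f.Monic ∧ 0 < f.natDegree ∧
      AdjoinRoot.mk f x ∈ (IsLocalRing.maximalIdeal R).map (algebraMap R (AdjoinRoot f)) ∧
      Ideal.span {AdjoinRoot.mk f x} *
          (IsLocalRing.maximalIdeal R ^ n).map (algebraMap R (AdjoinRoot f)) =
        (IsLocalRing.maximalIdeal R ^ (n + 1)).map (algebraMap R (AdjoinRoot f)) := by
  obtain ⟨f, t, hf, hdeg, hu, hst⟩ := exists_monic_isUnit_mk s hs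
  have hmap : ∀ I : Ideal R, (I.map C).map (AdjoinRoot.mk f) = I.map (algebraMap R _) :=
    fun I => Ideal.map_map _ _
  have hmem : ∀ p : R[X], (∀ i, p.coeff i ∈ IsLocalRing.maximalIdeal R) →
      AdjoinRoot.mk f p ∈ (IsLocalRing.maximalIdeal R).map (algebraMap R (AdjoinRoot f)) := by
    intro p hp
    rw [← hmap]
    exact Ideal.mem_map_of_mem _ (Ideal.mem_map_C_iff.mpr hp)
  have hfin := hf.finite_adjoinRoot
  refine ⟨f, hf, hdeg, hmem x hx, le_antisymm ?_ ?_⟩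
  · rw [pow_succ' _ n, Ideal.map_mul]
    exact Ideal.mul_mono_left ((Ideal.span_singleton_le_iff_mem _).mpr (hmem x hx))
  · set J := (IsLocalRing.maximalIdeal R ^ (n + 1)).map (algebraMap R (AdjoinRoot f)) with hJ
    set L := Ideal.span {AdjoinRoot.mk f x} *
      (IsLocalRing.maximalIdeal R ^ n).map (algebraMap R (AdjoinRoot f)) with hL
    -- Up to the unit t, an element y of 𝔪^(n+1) is s·y, which lies in L, minus (s - t)·y, which
    -- lies in 𝔪J. Nakayama over R then removes 𝔪J.
    have key : J ≤ L ⊔ (IsLocalRing.maximalIdeal R).map (algebraMap R (AdjoinRoot f)) • J := by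
      rw [hJ, Ideal.map_le_iff_le_comap]
      intro y hy
      rw [Ideal.mem_comap, ← hJ, ← Ideal.unit_mul_mem_iff_mem _ hu]
      have hsplit : AdjoinRoot.mk f t * algebraMap R (AdjoinRoot f) y =
          AdjoinRoot.mk f (s * C y) - AdjoinRoot.mk f (s - t) * algebraMap R (AdjoinRoot f) y := by
        rw [map_mul, map_sub, AdjoinRoot.mk_C, AdjoinRoot.algebraMap_eq]
        ring
      rw [hsplit]
      refine Ideal.sub_mem _ (Ideal.mem_sup_left ?_) (Ideal.mem_sup_right ?_)
      · have := Ideal.mem_map_of_mem (AdjoinRoot.mk f) (hsx y hy)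
        rwa [Ideal.map_mul, Ideal.map_span, Set.image_singleton, hmap] at this
      · exact Ideal.mul_mem_mul (hmem _ hst) (Ideal.mem_map_of_mem _ hy)
    have key' : J.restrictScalars R ≤
        L.restrictScalars R ⊔ IsLocalRing.maximalIdeal R • J.restrictScalars R := by
      rw [← Ideal.smul_restrictScalars, ← Submodule.restrictScalars_sup]
      exact key
    have := isNoetherian_of_isNoetherianRing_of_finite R (AdjoinRoot f)
    have hle : J.restrictScalars R ≤ L.restrictScalars R :=
      Submodule.le_of_le_smul_of_le_jacobson_bot (IsNoetherian.noetherian _)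
        (IsLocalRing.maximalIdeal_le_jacobson _) key'
    exact hle

end Extension

/-! ### Increments of a sequence of linear growth -/

section Sequences

theorem le_of_tendsto_div_of_add_le {a : ℕ → ℝ} {c e : ℝ} {N : ℕ}
    (ha : ∀ n ≥ N, a n + c ≤ a (n + 1)) (h : Tendsto (fun n : ℕ => a n / n) atTop (𝓝 e)) :
    c ≤ e := by
  have h1 : ∀ j, a N + c * j ≤ a (N + j) := by
    intro j
    induction j with
    | zero => simp
    | succ j ih =>
      have := ha (N + j) (by omega)
      push_cast
      rw [← add_assoc]
      linarith
  have h2 : Tendsto (fun n : ℕ => (a N - c * N) / n + c) atTop (𝓝 (0 + c)) :=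
    (tendsto_const_div_atTop_nhds_zero_nat _).add_const c
  rw [zero_add] at h2
  refine le_of_tendsto_of_tendsto h2 h ?_
  filter_upwards [eventually_ge_atTop (N + 1)] with n hn
  obtain ⟨j, rfl⟩ : ∃ j, n = N + j := ⟨n - N, by omega⟩
  have hpos : (0 : ℝ) < ((N + j : ℕ) : ℝ) := by exact_mod_cast (by omega : 0 < N + j)
  rw [div_add' _ _ _ hpos.ne']
  refine (div_le_div_iff_of_pos_right hpos).mpr ?_
  have := h1 j
  push_cast
  linarith

theorem exists_eq_of_tendsto_div {h μ : ℕ → ℕ} {k e : ℕ} (hμ : ∀ n, h (n + 1) = h n + μ n)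
    (hmono : ∀ n ≥ k, μ n ≤ μ (n + 1))
    (hlim : Tendsto (fun n : ℕ => (h n : ℝ) / n) atTop (𝓝 (e : ℝ))) :
    ∃ n ≥ k, μ n = e ∧ μ (n + 1) = e := by
  have hmono' : ∀ n ≥ k, ∀ j, μ n ≤ μ (n + j) := by
    intro n hn j
    induction j with
    | zero => exact le_rfl
    | succ j ih => exact ih.trans (hmono (n + j) (by omega))
  have hle : ∀ n ≥ k, μ n ≤ e := by
    intro n hn
    have : ((μ n : ℕ) : ℝ) ≤ e := by
      refine le_of_tendsto_div_of_add_le (a := fun n => (h n : ℝ)) (N := n) (fun l hl => ?_) hlim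
      obtain ⟨j, rfl⟩ : ∃ j, l = n + j := ⟨l - n, by omega⟩
      exact_mod_cast (by rw [hμ]; exact Nat.add_le_add_left (hmono' n hn j) _ :
        h (n + j) + μ n ≤ h (n + j + 1))
    exact_mod_cast this
  obtain ⟨n, hn, hne⟩ : ∃ n ≥ k, e ≤ μ n := by
    by_contra! hcon
    -- If all increments from k on were at most e - 1, then -h would grow by at least 1 - e at each
    -- step.
    have : (1 - e : ℝ) ≤ -e := by
      refine le_of_tendsto_div_of_add_le (a := fun n => -(h n : ℝ)) (N := k) (fun l hl => ?_) ?_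
      · have h1 := hcon l hl
        have h2 : ((h (l + 1) : ℕ) : ℝ) = h l + μ l := by exact_mod_cast hμ l
        have h3 : (μ l : ℝ) + 1 ≤ e := by exact_mod_cast h1
        rw [h2]
        linarith
      · simpa only [neg_div] using hlim.neg
    linarith
  have h1 : μ n = e := le_antisymm (hle n hn) hne
  exact ⟨n, hn, h1, le_antisymm (hle _ (by omega)) (h1 ▸ hmono n hn)⟩

end Sequences

/-! ### Part 2: minimal multiplicity -/

section MinimalMultiplicity

variable {R : Type*} [CommRing R]

theorem length_quotient_map_algebraMap {A : Type*} [CommRing A] [Algebra R A] [Nontrivial R]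
    [Module.Free R A] [Module.Finite R A] (I : Ideal R) :
    Module.length R (A ⧸ I.map (algebraMap R A)) =
      Module.finrank R A * Module.length R (R ⧸ I) := by
  have e1 : (A ⧸ I.map (algebraMap R A)) ≃ₗ[R] A ⧸ (I • (⊤ : Submodule R A)) :=
    (Submodule.Quotient.restrictScalarsEquiv R (I.map (algebraMap R A))).symm.trans
      (Submodule.quotEquivOfEq _ _ (Ideal.smul_top_eq_map I).symm)
  have e2 : (A ⧸ (I • (⊤ : Submodule R A))) ≃ₗ[R] A ⊗[R] (R ⧸ I) :=
    (TensorProduct.quotTensorEquivQuotSMul A I).symm.trans (TensorProduct.comm R _ _)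
  have e3 : A ⊗[R] (R ⧸ I) ≃ₗ[R] (Fin (Module.finrank R A) → R) ⊗[R] (R ⧸ I) :=
    TensorProduct.congr (Module.finBasis R A).equivFun (LinearEquiv.refl R _)
  rw [(e1.trans (e2.trans e3)).length_eq, length_pi_tensor]

/-- Multiplication by x maps A isomorphically onto xA and J onto xJ, so A/J and xA/xJ have the same
length. -/
theorem length_quotient_span_singleton_mul {A : Type*} [CommRing A] [Algebra R A] {x : A}
    (hx : Function.Injective (LinearMap.mulLeft R x)) (J : Ideal A) :
    Module.length R (A ⧸ Ideal.span {x} * J) =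
      Module.length R (A ⧸ J) + Module.length R (A ⧸ Ideal.span {x}) := by
  have h := cokerLength_comp (J.restrictScalars R).subtype (LinearMap.mulLeft R x) hx
  have h1 : LinearMap.range (LinearMap.mulLeft R x ∘ₗ (J.restrictScalars R).subtype) =
      (Ideal.span {x} * J).restrictScalars R := by
    ext y
    rw [Submodule.restrictScalars_mem, Ideal.mem_span_singleton_mul]
    exact ⟨fun ⟨z, hz⟩ => ⟨z, z.2, hz⟩, fun ⟨z, hz, hzy⟩ => ⟨⟨z, hz⟩, hzy⟩⟩
  have h2 : LinearMap.range (LinearMap.mulLeft R x) = (Ideal.span {x}).restrictScalars R := by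
    ext y
    rw [Submodule.restrictScalars_mem, Ideal.mem_span_singleton]
    exact ⟨fun ⟨z, hz⟩ => ⟨z, hz.symm⟩, fun ⟨z, hz⟩ => ⟨z, hz.symm⟩⟩
  rw [cokerLength, cokerLength, cokerLength, h1, h2, Submodule.range_subtype,
    (Submodule.Quotient.restrictScalarsEquiv R (Ideal.span {x} * J)).length_eq,
    (Submodule.Quotient.restrictScalarsEquiv R J).length_eq,
    (Submodule.Quotient.restrictScalarsEquiv R (Ideal.span {x})).length_eq] at h
  exact h

theorem eq_of_le_of_length_quotient_eq {N : Type*} [AddCommGroup N] [Module R N]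
    {P Q : Submodule R N} (hle : P ≤ Q) (hfin : Module.length R (N ⧸ Q) ≠ ⊤)
    (h : Module.length R (N ⧸ P) = Module.length R (N ⧸ Q)) : P = Q := by
  have h1 := cokerLength_comp (Submodule.inclusion hle) Q.subtype Q.subtype_injective
  rw [Submodule.subtype_comp_inclusion, cokerLength, Submodule.range_subtype, h] at h1
  have h2 : cokerLength Q.subtype = Module.length R (N ⧸ Q) := by
    rw [cokerLength, Submodule.range_subtype]
  rw [h2] at h1
  have h3 : cokerLength (Submodule.inclusion hle) = 0 :=
    (WithTop.add_right_cancel hfin ((zero_add _).trans h1)).symm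
  rw [cokerLength_eq_zero_iff] at h3
  refine le_antisymm hle fun y hy => ?_
  obtain ⟨z, hz⟩ := h3 ⟨y, hy⟩
  have hzy : (z : N) = y := congrArg Subtype.val hz
  exact hzy ▸ z.2

variable [IsNoetherianRing R] [IsLocalRing R]

theorem HasMinimalMultiplicity.tendsto (hdim : ringKrullDim R = 1)
    (h : HasMinimalMultiplicity R) :
    Tendsto (fun n : ℕ => (hilbertSamuel R n : ℝ) / n) atTop
      (𝓝 (minGenerators (IsLocalRing.maximalIdeal R) : ℝ)) := by
  obtain ⟨d, e, hd, ⟨d', hd', hlim⟩, he⟩ := h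
  obtain rfl : d = 1 := by rw [hdim] at hd; exact_mod_cast hd.symm
  obtain rfl : d' = 1 := by rw [hdim] at hd'; exact_mod_cast hd'.symm
  obtain rfl : e = embDim R := by omega
  rw [← embDim_eq_minGenerators]
  simpa using hlim

variable [Ring.KrullDimLE 1 R]

theorem length_quotient_pow_ne_top {c : R} (hcm : c ∈ IsLocalRing.maximalIdeal R)
    (hc : c ∈ nonZeroDivisors R) (n : ℕ) :
    Module.length R (R ⧸ IsLocalRing.maximalIdeal R ^ n) ≠ ⊤ := by
  refine finite_length_of_smul_eq_zero (c ^ n) (pow_mem hc n) fun y => ?_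
  obtain ⟨y, rfl⟩ := Submodule.Quotient.mk_surjective _ y
  rw [← Submodule.Quotient.mk_smul, Submodule.Quotient.mk_eq_zero]
  exact Ideal.mul_mem_right _ _ (Ideal.pow_mem_pow hcm n)

/-- Comparing A/x𝔪^nA with A/𝔪^(n+1)A gives λ(A/xA) = rank(A)·μ(𝔪^n) = rank(A)·μ(𝔪). Hence x𝔪A ⊆ 𝔪²A
have equal finite colength, and they coincide. -/
theorem map_sq_le_span_of_minGenerators_eq {A : Type*} [CommRing A] [Algebra R A]
    [Module.Free R A] [Module.Finite R A] {c : R} (hcm : c ∈ IsLocalRing.maximalIdeal R)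
    (hc : c ∈ nonZeroDivisors R) {x : A} (hx : Function.Injective (LinearMap.mulLeft R x))
    (hxm : x ∈ (IsLocalRing.maximalIdeal R).map (algebraMap R A)) {n : ℕ}
    (hxn : Ideal.span {x} * (IsLocalRing.maximalIdeal R ^ n).map (algebraMap R A) =
      (IsLocalRing.maximalIdeal R ^ (n + 1)).map (algebraMap R A))
    (h : minGenerators (IsLocalRing.maximalIdeal R ^ n) =
      minGenerators (IsLocalRing.maximalIdeal R)) :
    (IsLocalRing.maximalIdeal R ^ 2).map (algebraMap R A) ≤ Ideal.span {x} := by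
  set 𝔪 := IsLocalRing.maximalIdeal R with h𝔪
  have hfin := length_quotient_pow_ne_top hcm hc
  have h1 := length_quotient_span_singleton_mul hx ((𝔪 ^ n).map (algebraMap R A))
  rw [hxn, length_quotient_map_algebraMap, length_quotient_map_algebraMap, pow_succ',
    length_quotient_maximalIdeal_mul, h, mul_add] at h1
  have h2 : Module.length R (A ⧸ Ideal.span {x}) =
      Module.finrank R A * (minGenerators 𝔪 : ℕ∞) :=
    (WithTop.add_left_cancel (WithTop.mul_ne_top (ENat.natCast_ne_top _) (hfin n)) h1).symm
  have h3 := length_quotient_span_singleton_mul hx (𝔪.map (algebraMap R A))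
  rw [h2, length_quotient_map_algebraMap, ← mul_add, ← length_quotient_maximalIdeal_mul,
    ← length_quotient_map_algebraMap, ← pow_two] at h3
  have hle : Ideal.span {x} * 𝔪.map (algebraMap R A) ≤ (𝔪 ^ 2).map (algebraMap R A) := by
    rw [pow_two, Ideal.map_mul]
    exact Ideal.mul_mono_left ((Ideal.span_singleton_le_iff_mem _).mpr hxm)
  have h4 : (Ideal.span {x} * 𝔪.map (algebraMap R A)).restrictScalars R =
      ((𝔪 ^ 2).map (algebraMap R A)).restrictScalars R := by
    refine eq_of_le_of_length_quotient_eq hle ?_ ?_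
    · rw [(Submodule.Quotient.restrictScalarsEquiv R _).length_eq,
        length_quotient_map_algebraMap]
      exact WithTop.mul_ne_top (ENat.natCast_ne_top _) (hfin 2)
    · rw [(Submodule.Quotient.restrictScalarsEquiv R _).length_eq,
        (Submodule.Quotient.restrictScalarsEquiv R _).length_eq, h3]
  have h5 : (𝔪 ^ 2).map (algebraMap R A) ≤ Ideal.span {x} * 𝔪.map (algebraMap R A) := h4.ge
  exact h5.trans Ideal.mul_le_left

theorem hilbertSamuel_succ {c : R} (hcm : c ∈ IsLocalRing.maximalIdeal R)
    (hc : c ∈ nonZeroDivisors R) (n : ℕ) :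
    hilbertSamuel R (n + 1) =
      hilbertSamuel R n + minGenerators (IsLocalRing.maximalIdeal R ^ n) := by
  rw [hilbertSamuel, pow_succ', length_quotient_maximalIdeal_mul,
    ENat.toNat_add (length_quotient_pow_ne_top hcm hc n) (ENat.natCast_ne_top _),
    ENat.toNat_natCast, hilbertSamuel]

open Polynomial in
theorem free_of_hasMinimalMultiplicity (hdim : ringKrullDim R = 1)
    (hmin : HasMinimalMultiplicity R) {M : Type*} [AddCommGroup M] [Module R M]
    [Module.Finite R M] {r : ℕ} (hM : GenericallyFree R M r) (hr : 0 < r)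
    (htf : Module.IsTorsionFree R (M ⊗[R] Module.Dual R M)) {c : R}
    (hcm : c ∈ IsLocalRing.maximalIdeal R) (hc : c ∈ nonZeroDivisors R)
    (htr : traceIdeal R M ≤ IsLocalRing.maximalIdeal R) : Module.Free R M := by
  obtain ⟨x, hx, hxJ⟩ := exists_polynomial_of_fg
    (IsNoetherian.noetherian (IsLocalRing.maximalIdeal R))
  obtain ⟨k, hk⟩ := exists_forall_mem_pow_of_mul_mem_pow_succ _ hcm hc
  have hk' : ∀ n ≥ k, ∀ a : R, (∀ i, a * x.coeff i ∈ IsLocalRing.maximalIdeal R ^ (n + 1)) →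
      a ∈ IsLocalRing.maximalIdeal R ^ n := fun n hn a ha => hk n hn a (hxJ _ a ha)
  obtain ⟨n, hn, hn1, hn2⟩ := exists_eq_of_tendsto_div (hilbertSamuel_succ hcm hc)
    (fun n hn => (minGenerators_pow_le_and_exists hx hk' hn).1) (hmin.tendsto hdim)
  obtain ⟨s, hs, hsx⟩ := (minGenerators_pow_le_and_exists hx hk' hn).2 (hn1.trans hn2.symm)
  obtain ⟨f, hf, hdeg, hxm, hxn⟩ := exists_monic_map_pow_succ_eq hx hs hsx
  have := hf.free_adjoinRoot
  have := hf.finite_adjoinRoot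
  -- Since 𝔪^(n+1)A ⊆ xA, x divides a nonzerodivisor of R and is therefore regular on A.
  have hxc : algebraMap R (AdjoinRoot f) (c ^ (n + 1)) ∈ Ideal.span {AdjoinRoot.mk f x} :=
    (hxn.ge.trans Ideal.mul_le_left) (Ideal.mem_map_of_mem _ (Ideal.pow_mem_pow hcm _))
  have hinj : Function.Injective (LinearMap.mulLeft R (AdjoinRoot.mk f x)) := by
    obtain ⟨z, hz⟩ := Ideal.mem_span_singleton'.mp hxc
    refine injective_of_comp_eq_smul (g := LinearMap.mulLeft R z) (c := c ^ (n + 1)) ?_ ?_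
    · refine LinearMap.ext fun y => ?_
      simp only [LinearMap.comp_apply, LinearMap.mulLeft_apply, LinearMap.smul_apply,
        LinearMap.id_apply]
      rw [← mul_assoc, hz, Algebra.smul_def]
    · exact ((Module.Free.chooseBasis R (AdjoinRoot f)).equivFun.isSMulRegular_congr _).mpr
        (IsSMulRegular.pi fun _ => (isRegular_iff_mem_nonZeroDivisors.mpr (pow_mem hc _)).1)
  have hunit : ¬ IsUnit (AdjoinRoot.mk f x) := by
    intro hu
    have htop := Ideal.eq_top_of_isUnit_mem _ hxm hu
    have hlen := length_quotient_map_algebraMap (A := AdjoinRoot f) (IsLocalRing.maximalIdeal R)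
    have : Subsingleton (AdjoinRoot f ⧸
        (IsLocalRing.maximalIdeal R).map (algebraMap R (AdjoinRoot f))) :=
      Ideal.Quotient.subsingleton_iff.mpr htop
    rw [Module.length_eq_zero, eq_comm, mul_eq_zero, Module.length_eq_zero_iff,
      Ideal.Quotient.subsingleton_iff] at hlen
    rcases hlen with h | h
    · have hrank := (AdjoinRoot.powerBasis' hf).finrank
      rw [AdjoinRoot.powerBasis'_dim] at hrank
      have : Module.finrank R (AdjoinRoot f) = 0 := by exact_mod_cast h
      omega
    · exact (IsLocalRing.maximalIdeal.isMaximal R).ne_top h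
  refine free_of_mul_traceIdeal_le hM hr htf (AdjoinRoot.mk f x) hunit (pow_mem hc (n + 1)) hxc
    fun a ha t ht => ?_
  refine map_sq_le_span_of_minGenerators_eq hcm hc hinj hxm hxn hn1
    (Ideal.mem_map_of_mem _ ?_)
  rw [pow_two]
  exact Ideal.mul_mem_mul ha (htr ht)

end MinimalMultiplicity

theorem corollary3p5 {R : Type*} [CommRing R] [IsNoetherianRing R] [IsLocalRing R]
    (hdim : ringKrullDim R = 1)
    {M : Type*} [AddCommGroup M] [Module R M] [Module.Finite R M]
    (r : ℕ) (hrank : HasModuleRank R M r) (hr : 0 < r ∨ Subsingleton M)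
    (htf : Module.IsTorsionFree R (M ⊗[R] Module.Dual R M)) :
    ((∃ (x : R) (n : ℕ), traceIdeal R M ≤ IsLocalRing.maximalIdeal R ^ n ∧
        Ideal.span {x} * IsLocalRing.maximalIdeal R ^ n =
          IsLocalRing.maximalIdeal R ^ (n + 1)) → Module.Free R M) ∧
      (HasMinimalMultiplicity R → Module.Free R M) := by
  -- In depth zero the rank condition at 𝔪 settles both parts. Otherwise the associated primes are
  -- incomparable and 𝔪 contains a nonzerodivisor.
  by_cases hm : IsLocalRing.maximalIdeal R ∈ associatedPrimes R R
  · have := free_of_maximalIdeal_mem_associatedPrimes hrank hm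
    exact ⟨fun _ => this, fun _ => this⟩
  have : Ring.KrullDimLE 1 R := Ring.krullDimLE_iff.mpr hdim.le
  have hinc := associatedPrimes_eq_of_le hm
  obtain ⟨c, hcm, hc⟩ := exists_mem_nonZeroDivisors_of_maximalIdeal_notMem_associatedPrimes hm
  refine ⟨?_, fun hmin => ?_⟩
  · rintro ⟨x, n, htr, hx⟩
    rcases hr with hr | hr
    · exact free_of_traceIdeal_le_pow (genericallyFree_of_hasModuleRank hrank hinc) hr htf hcm hc
        x n htr hx
    · exact Module.Free.of_subsingleton R M
  · exact free_of_free_of_traceIdeal_le hinc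
      (fun N _ _ _ s hN hs hNtf htr => free_of_hasMinimalMultiplicity hdim hmin
        (genericallyFree_of_hasModuleRank hN hinc) hs hNtf hcm hc htr) r M hrank hr htf
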